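/- Let $\mathcal U=\bigcup_{n\ge 0}(\mathbb N^*)^n$, ordered lexicographically ($u<v$ if $u$ is a proper prefix of $v$, or if $u=wiu'$, $v=wjv'$ with $i<j$). A tree is a set $\mathbf t\subset\mathcal U$ that contains $\emptyset$ and all prefixes (ancestors, including itself) of each of its elements, and such that every $u\in\mathbf t$ has a finite number $k_u(\mathbf t)\ge 0$ of children, these being $ui$, $1\le i\le k_u(\mathbf t)$. For $u\in\mathbf t$ put $S_u(\mathbf t)=\{v:\ uv\in\mathbf t\}$. A random tree $\tau$ is a Galton-Watson (GW) tree with offspring distribution $p$ if $k_\emptyset(\tau)$ has law $p$ and, conditionally on $k_\emptyset(\tau)=n$, the trees $S_1(\tau),\dots,S_n(\tau)$ are independent and distributed as $\tau$. Offspring distributions $p$ are assumed to satisfy $p(0)>0$, $p(0)+p(1)<1$ and $\mu=\sum_n np(n)<\infty$; the GW tree is critical if $\mu=1$. Rizzolo's map $\phi$. Let $\mathbf t$ be a finite tree and $A\subset\mathbf t$ non-empty, with smallest element $u_0$. Let $u_1<\dots<u_k$ be the vertices of $\mathbf t$ that are larger than $u_0$, are children of an ancestor of $u_0$ ($u_0$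 included), and are ancestors of an element of $A$. Then $\phi(\mathbf t,A)$ is the tree whose root has $k$ children and for which, recursively, $S_i(\phi(\mathbf t,A))=\phi\bigl(S_{u_i}(\mathbf t),\{v:\ u_iv\in A\}\bigr)$ for $1\le i\le k$. Let $p$ be a critical offspring distribution as above, and let $q:\mathbb N\to[0,1]$ be such that $p(k)q(k)>0$ for some $k$. Let $(\tau,\mathcal M(\tau))$ be a marked GW tree with offspring distribution $p$ and mark function $q$: $\tau$ is a GW tree with offspring distribution $p$, $\mathcal M(\tau)\subset\tau$ is the set of marked vertices and, conditionally on $\tau=\mathbf t$, the vertices $u\in\mathbf t$ are marked independently with probabilities $q(k_u(\mathbf t))$. Let $\gamma=\mathbb P(\mathcal M(\tau)\ne\emptyset)$. Let $(X_i,Z_i)_{i\ge1}$ be i.i.d. with $X_i$ of law $p$ and $Z_i$, given $X_i$, Bernoulli with parameter $q(X_i)$. Put $G=\inf\{k\ge1:\ \sum_{i=1}^k(X_i-1)=-1\}$ and $N=\inf\{k\ge1:\ Z_k=1\}$. Let $\tilde X$ be distributed as $1+\sum_{i=1}^N(X_i-1)$ conditionally on $\{N\le G\}$, and let $Y$ be,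 conditionally on $\tilde X$, binomial with parameter $(\tilde X,\gamma)$. **Lemma.** Let $(\tau^0,\mathcal M(\tau^0))$ be distributed as $(\tau,\mathcal M(\tau))$ conditioned on $\{\mathcal M(\tau)\ne\emptyset\}$. Then $\phi(\tau^0,\mathcal M(\tau^0))$ is a critical GW tree whose offspring distribution is the law of $Y$: it is a GW tree with offspring distribution the law of $Y$, and this law satisfies $\mathbb P(Y=0)>0$, $\mathbb P(Y=0)+\mathbb P(Y=1)<1$ and $\mathbb E[Y]=1$. -/

import Mathlib

open MeasureTheory ProbabilityTheory
open scoped ENNReal unitInterval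

namespace MarkedGW

/-- The set `𝒰` of finite sequences of positive integers. Its order is the lexicographic order in
which a sequence comes before its proper extensions; `v <+: u` says that `v` is an ancestor
of `u` (every `u` is an ancestor of itself). -/
abbrev Vertex : Type := List ℕ+

/-- Ordered rooted trees (finite or infinite, all out-degrees finite), as sets of vertices.
Sets of vertices carry the product sigma-algebra, generated by the events `u ∈ t`; on trees it
is the Borel sigma-algebra of the local topology. -/
structure IsTree (t : Set Vertex) : Prop where
  root_mem : [] ∈ t
  ancestor_mem : ∀ u ∈ t, ∀ v : Vertex, v <+: u → v ∈ t
  children : ∀ u ∈ t, ∃ k : ℕ, ∀ i : ℕ+, u ++ [i] ∈ t ↔ (i : ℕ) ≤ k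

/-- The set `C_u(t)` of children of `u` in `t`. -/
def children (t : Set Vertex) (u : Vertex) : Set Vertex :=
  {v | v ∈ t ∧ ∃ i : ℕ+, v = u ++ [i]}

/-- The number `k_u(t)` of children of a vertex `u` of the tree `t`. -/
noncomputable def outDegree (t : Set Vertex) (u : Vertex) : ℕ := (children t u).ncard

/-- `S_u(A) = {v ; uv ∈ A}`. For a vertex `u` of a tree `t`, `S_u(t)` is the subtree of `t`
above `u`, re-rooted at the empty sequence. -/
def shift (u : Vertex) (A : Set Vertex) : Set Vertex := {v | u ++ v ∈ A}

/-! ### Galton-Watson trees -/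

/-- The mean of a distribution on `ℕ`, in `[0, ∞]`. -/
noncomputable def mean (p : Measure ℕ) : ℝ≥0∞ := ∫⁻ n, (n : ℝ≥0∞) ∂p

/-- The standing assumptions on an offspring distribution. -/
structure IsOffspringLaw (p : Measure ℕ) : Prop where
  isProbabilityMeasure : IsProbabilityMeasure p
  zero_pos : 0 < p {0}
  zero_add_one_lt : p {0} + p {1} < 1
  mean_lt_top : mean p < ∞

/-- `τ` is, under `P`, a Galton-Watson tree with offspring distribution `p`: the number of children
of the root has law `p`, and conditionally on its being `n` the subtrees above the `n` children of
the root (labelled `1, …, n`) are independent and distributed as `τ`. -/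
structure IsGWTree {Ω : Type*} [MeasurableSpace Ω] (P : Measure Ω) (τ : Ω → Set Vertex)
    (p : Measure ℕ) : Prop where
  measurable : Measurable τ
  isTree : ∀ ω, IsTree (τ ω)
  root_law : ∀ n : ℕ, P {ω | outDegree (τ ω) [] = n} = p {n}
  indep : ∀ n : ℕ, P {ω | outDegree (τ ω) [] = n} ≠ 0 →
    iIndepFun (fun (i : Fin n) (ω : Ω) => shift [Nat.succPNat i] (τ ω))
      (P[|{ω | outDegree (τ ω) [] = n}])
  identDistrib : ∀ n : ℕ, P {ω | outDegree (τ ω) [] = n} ≠ 0 → ∀ i : Fin n,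
    IdentDistrib (fun ω => shift [Nat.succPNat i] (τ ω)) τ
      (P[|{ω | outDegree (τ ω) [] = n}]) P

/-- `(τ, M)` is, under `P`, a marked Galton-Watson tree with offspring distribution `p` and mark
function `q`: conditionally on `τ = t`, the vertices `u` of `t` belong to the set `M` of marked
vertices independently of each other, with probability `q (k_u(t))`. (For a critical or subcritical
offspring distribution, `τ` is a.s. finite, so that the events `τ = t` of positive
probability exhaust the probability space up to a null set.) -/
structure IsMarkedGWTree {Ω : Type*} [MeasurableSpace Ω] (P : Measure Ω) (τ M : Ω → Set Vertex)
    (p : Measure ℕ) (q : ℕ → I) : Prop where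
  isGWTree : IsGWTree P τ p
  measurable_marks : Measurable M
  marks_subset : ∀ ω, M ω ⊆ τ ω
  indep : ∀ t : Set Vertex, P {ω | τ ω = t} ≠ 0 →
    iIndepSet (fun u : t => {ω | (u : Vertex) ∈ M ω}) (P[|{ω | τ ω = t}])
  prob : ∀ t : Set Vertex, P {ω | τ ω = t} ≠ 0 → ∀ u ∈ t,
    P[|{ω | τ ω = t}] {ω | u ∈ M ω} = ENNReal.ofReal (q (outDegree t u) : ℝ)

/-! ### Rizzolo's map -/

/-- `R_u(t)`: the vertices of `t` that are larger than `u` and are children of an ancestor of `u`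
(`u` itself included). -/
def rightSet (t : Set Vertex) (u : Vertex) : Set Vertex :=
  {v | ∃ w : Vertex, w <+: u ∧ v ∈ children t w ∧ u < v}

/-- `R_u^A(t)`: the vertices of `R_u(t)` that have a descendant (or themselves) in `A`. -/
def rightSetOf (t A : Set Vertex) (u : Vertex) : Set Vertex :=
  {v | v ∈ rightSet t u ∧ ∃ a ∈ A, v <+: a}

/-- Membership of a vertex in the image of `(t, A)` under Rizzolo's map. Let `u₀` be the smallest
element of `A` and `u₁ < ⋯ < u_k` the elements of `R_{u₀}^A(t)`. Then the root of the image has the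
`k` children `1, …, k`, and the subtree above the child `i` is the image of the subtree of `t` above
`u_i` with the part of `A` in it; `u_i` is the element of `R_{u₀}^A(t)` for which exactly
`i` elements of this (finite) set are `≤ u_i`. -/
def rizzoloMem : Vertex → Set Vertex → Set Vertex → Prop
  | [], _, _ => True
  | i :: v, t, A => ∃ u₀ u : Vertex, IsLeast A u₀ ∧ u ∈ rightSetOf t A u₀ ∧
      {w | w ∈ rightSetOf t A u₀ ∧ w ≤ u}.ncard = (i : ℕ) ∧
      rizzoloMem v (shift u t) (shift u A)

/-- Rizzolo's map `φ(t, A)`. -/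
def rizzolo (t A : Set Vertex) : Set Vertex := {v | rizzoloMem v t A}

/-! ### The random variable `Y`

Sequences are indexed from `0`: `X i` and `Z i` stand for `X_{i+1}` and `Z_{i+1}`. -/

/-- The pairs `(X_i, Z_i)` are i.i.d., `X_i` has law `p` and, given `X_i`, `Z_i` is Bernoulli with
parameter `q(X_i)` (`Z_i = true` with probability `q(X_i)`). -/
structure IsMarkedWalk {Ω : Type*} [MeasurableSpace Ω] (P : Measure Ω) (X : ℕ → Ω → ℕ)
    (Z : ℕ → Ω → Bool) (p : Measure ℕ) (q : ℕ → I) : Prop where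
  measurable_steps : ∀ i, Measurable (X i)
  measurable_marks : ∀ i, Measurable (Z i)
  indep : iIndepFun (fun i ω => (X i ω, Z i ω)) P
  step_law : ∀ i n, P {ω | X i ω = n} = p {n}
  mark_law : ∀ i n, P {ω | X i ω = n ∧ Z i ω = true} = p {n} * ENNReal.ofReal (q n : ℝ)

/-- The sum of `X_i - 1` over the first `k` indices. -/
def walk {Ω : Type*} (X : ℕ → Ω → ℕ) (k : ℕ) (ω : Ω) : ℤ :=
  ∑ i ∈ Finset.range k, ((X i ω : ℤ) - 1)

/-- `G = inf {k ≥ 1 ; ∑_{i ≤ k} (X_i - 1) = -1}`, with `inf ∅ = ∞`. -/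
noncomputable def hitTime {Ω : Type*} (X : ℕ → Ω → ℕ) (ω : Ω) : ℕ∞ :=
  ⨅ (k : ℕ) (_ : 1 ≤ k ∧ walk X k ω = -1), (k : ℕ∞)

/-- `N = inf {k ≥ 1 ; Z_k = 1}`, with `inf ∅ = ∞`. -/
noncomputable def markTime {Ω : Type*} (Z : ℕ → Ω → Bool) (ω : Ω) : ℕ∞ :=
  ⨅ (j : ℕ) (_ : Z j ω = true), ((j + 1 : ℕ) : ℕ∞)

/-- Given `Xt`, the variable `Y` is binomial with parameter `(Xt, γ)`. -/
def IsBinomialGiven {Ω : Type*} [MeasurableSpace Ω] (P : Measure Ω) (Xt Y : Ω → ℕ) (γ : ℝ) : Prop :=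
  ∀ n k : ℕ, P {ω | Xt ω = n ∧ Y ω = k} =
    P {ω | Xt ω = n} * ENNReal.ofReal ((n.choose k : ℝ) * γ ^ k * (1 - γ) ^ (n - k))

end MarkedGW

namespace MarkedGW

/-! ### Trees as sets of vertices -/

/-! A critical tree is almost surely finite, so the marked tree is carried by the countable type
`MTree` of finite marked trees, where each atom has mass `weight (markedWeight p q)`, a product over
vertices. Probabilities become sums over `MTree` (`IsMarkedGWTree.measure_setOf`), and independence
becomes factorization of these sums.

Explore the tree depth first: start from the forest consisting of the tree alone, and repeatedly
replace the first tree of the forest by the subtrees above the children of its root. The first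
marked vertex met is the smallest one, u₀, and the forest left just after it consists of the
subtrees above the vertices of R_{u₀}(t). Those containing a mark are the trees to which φ is
applied recursively (`exists_rightList`, `tsum_marked_parts`). A step can be undone once the number
of children is known; hence at every stage the forest, given its size, is made of independent copies
of the marked tree (`tsum_bind_step`). Its size moves like the walk with steps X_i - 1 started at 1.
The trees run out at time G and the first mark comes at time N, so having a mark corresponds to N ≤
G and the final size has the law of X̃ (`IsMarkedWalk.measure_hit`). Keeping the trees with a mark
is a binomial thinning of parameter γ: their number has the law of Y, and they are independent
copies of the conditioned tree (`tsum_parts_eq`). This is the branching property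
(`IsMarkedGWTree.cond_rizzolo`), which characterizes Galton-Watson trees (`isGWTree_of_branching`).

For the mean, optional stopping applies: a step preserves the mean size, and the mean size on the
event of no mark so far tends to 0 (`tsum_mul_hitLaw`). Thus E[X̃] = 1/γ and E[Y] = 1. Finally Y
charges some n ≥ 2 (`exists_hitLaw_ne_zero`), which with mean one forces P(Y = 0) > 0. -/

lemma outDegree_eq {t : Set Vertex} {u : Vertex} {k : ℕ}
    (h : ∀ i : ℕ+, u ++ [i] ∈ t ↔ (i : ℕ) ≤ k) : outDegree t u = k := by
  have : children t u = Set.range (fun i : Fin k => u ++ [Nat.succPNat i]) := by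
    ext v
    simp only [children, Set.mem_ofPred_eq, Set.mem_range]
    constructor
    · rintro ⟨hv, i, rfl⟩
      have := (h i).1 hv
      refine ⟨⟨i.natPred, ?_⟩, by simp⟩
      have := i.natPred_add_one
      omega
    · rintro ⟨i, rfl⟩
      refine ⟨(h _).2 ?_, _, rfl⟩
      simp only [Nat.succPNat_coe]
      omega
  rw [outDegree, this, ← Set.image_univ, Set.ncard_image_of_injective]
  · simp [Set.ncard_univ]
  · intro i j hij
    simp only [List.append_cancel_left_eq, List.cons.injEq, and_true] at hij
    exact Fin.ext (Nat.succPNat_injective hij)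

lemma IsTree.mem_children_iff {t : Set Vertex} (ht : IsTree t) {u : Vertex} (hu : u ∈ t) (i : ℕ+) :
    u ++ [i] ∈ t ↔ (i : ℕ) ≤ outDegree t u := by
  obtain ⟨k, hk⟩ := ht.children u hu
  rw [outDegree_eq hk, hk]

lemma IsTree.outDegree_root_eq_iff {t : Set Vertex} (ht : IsTree t) (n : ℕ) :
    outDegree t [] = n ↔ ∀ i : ℕ+, [i] ∈ t ↔ (i : ℕ) ≤ n := by
  constructor
  · rintro rfl i
    exact ht.mem_children_iff ht.root_mem i
  · intro h
    exact outDegree_eq h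

@[simp] lemma mem_shift {u v : Vertex} {A : Set Vertex} : v ∈ shift u A ↔ u ++ v ∈ A := Iff.rfl

lemma shift_append (u v : Vertex) (A : Set Vertex) : shift (u ++ v) A = shift v (shift u A) := by
  ext w
  simp [List.append_assoc]

lemma shift_cons (i : ℕ+) (v : Vertex) (A : Set Vertex) :
    shift (i :: v) A = shift v (shift [i] A) := shift_append [i] v A

lemma outDegree_append (t : Set Vertex) (u v : Vertex) :
    outDegree t (u ++ v) = outDegree (shift u t) v := by
  unfold outDegree
  have : children t (u ++ v) = (u ++ ·) '' children (shift u t) v := by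
    ext w
    simp only [children, Set.mem_ofPred_eq, Set.mem_image, mem_shift]
    constructor
    · rintro ⟨hw, i, rfl⟩
      exact ⟨v ++ [i], ⟨by simpa using hw, i, rfl⟩, by simp⟩
    · rintro ⟨_, ⟨hw, i, rfl⟩, rfl⟩
      exact ⟨hw, i, by simp⟩
  rw [this, Set.ncard_image_of_injective _ (List.append_right_injective u)]

lemma IsTree.shift {t : Set Vertex} (ht : IsTree t) {u : Vertex} (hu : u ∈ t) :
    IsTree (shift u t) where
  root_mem := by simpa using hu
  ancestor_mem v hv w hw := ht.ancestor_mem _ hv _ (by simpa using hw)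
  children v hv := by
    obtain ⟨k, hk⟩ := ht.children _ hv
    exact ⟨k, fun i => by simpa using hk i⟩

/-! ### Rizzolo's map through the sorted list of right vertices -/

/-- `U` lists, in increasing order, the elements of `R_{u₀}^A(t)`, where `u₀ = min A`. -/
def IsRightList (t A : Set Vertex) (U : List Vertex) : Prop :=
  ∃ u₀, IsLeast A u₀ ∧ U.Pairwise (· < ·) ∧ ∀ v, v ∈ U ↔ v ∈ rightSetOf t A u₀

/-- Since `rizzoloMem` designates u_i by counting the elements up to it, this turns counting into
list indexing. -/
lemma ncard_le_getElem {U : List Vertex} (hU : U.Pairwise (· < ·)) (j : ℕ) (hj : j < U.length) :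
    {w | w ∈ U ∧ w ≤ U[j]}.ncard = j + 1 := by
  have hlt := List.pairwise_iff_getElem.1 hU
  have : {w | w ∈ U ∧ w ≤ U[j]} = Set.range (fun a : Fin (j + 1) => U[(a : ℕ)]'(by omega)) := by
    ext w
    simp only [Set.mem_ofPred_eq, Set.mem_range]
    constructor
    · rintro ⟨hw, hle⟩
      obtain ⟨a, ha, rfl⟩ := List.mem_iff_getElem.1 hw
      refine ⟨⟨a, ?_⟩, rfl⟩
      by_contra h
      exact absurd (hlt j a hj ha (by omega)) (not_lt.2 hle)
    · rintro ⟨a, rfl⟩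
      refine ⟨List.getElem_mem _, ?_⟩
      rcases Nat.lt_or_ge a j with h | h
      · exact (hlt a j (by omega) hj h).le
      · have : (a : ℕ) = j := by omega
        simp [this]
  rw [this, ← Set.image_univ, Set.ncard_image_of_injective]
  · simp [Set.ncard_univ]
  · intro a b hab
    have hnd : U.Nodup := hU.imp (fun h => h.ne)
    exact Fin.ext ((hnd.getElem_inj_iff).1 hab)

@[simp] lemma nil_mem_rizzolo (t A : Set Vertex) : [] ∈ rizzolo t A := by
  simp [rizzolo, rizzoloMem]

lemma cons_mem_rizzolo {t A : Set Vertex} {U : List Vertex} (h : IsRightList t A U) (i : ℕ+)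
    (v : Vertex) : i :: v ∈ rizzolo t A ↔ ∃ hi : i.natPred < U.length,
      v ∈ rizzolo (shift U[i.natPred] t) (shift U[i.natPred] A) := by
  obtain ⟨u₀, hu₀, hU, hmem⟩ := h
  have key : i :: v ∈ rizzolo t A ↔ ∃ u, u ∈ U ∧ {w | w ∈ U ∧ w ≤ u}.ncard = (i : ℕ) ∧
      v ∈ rizzolo (shift u t) (shift u A) := by
    constructor
    · rintro ⟨u₁, u, h1, hu, hc, hv⟩
      obtain rfl := h1.unique hu₀
      refine ⟨u, (hmem u).2 hu, ?_, hv⟩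
      simpa only [hmem] using hc
    · rintro ⟨u, hu, hc, hv⟩
      refine ⟨u₀, u, hu₀, (hmem u).1 hu, ?_, hv⟩
      simpa only [hmem] using hc
  rw [key]
  have hi := i.natPred_add_one
  constructor
  · rintro ⟨u, hu, hc, hv⟩
    obtain ⟨a, ha, rfl⟩ := List.mem_iff_getElem.1 hu
    rw [ncard_le_getElem hU a ha] at hc
    obtain rfl : a = i.natPred := by omega
    exact ⟨ha, hv⟩
  · rintro ⟨h, hv⟩
    refine ⟨_, List.getElem_mem h, ?_, hv⟩
    rw [ncard_le_getElem hU _ h, hi]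

/-- The lexicographic order is not a well-order, so an infinite set of marks may lack a least
element; the image is then reduced to its root, as for the empty set. -/
lemma cons_notMem_rizzolo {t A : Set Vertex} (h : ¬ ∃ u₀, IsLeast A u₀) (i : ℕ+) (v : Vertex) :
    i :: v ∉ rizzolo t A := by
  rintro ⟨u₀, _, h1, _⟩
  exact h ⟨u₀, h1⟩

lemma rizzolo_outDegree {t A : Set Vertex} {U : List Vertex} (h : IsRightList t A U) :
    outDegree (rizzolo t A) [] = U.length := by
  refine outDegree_eq fun i => ?_
  rw [List.nil_append, cons_mem_rizzolo h]
  have hi := i.natPred_add_one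
  simp only [nil_mem_rizzolo, exists_prop, and_true]
  omega

lemma shift_rizzolo {t A : Set Vertex} {U : List Vertex} (h : IsRightList t A U) (i : ℕ)
    (hi : i < U.length) :
    shift [Nat.succPNat i] (rizzolo t A) = rizzolo (shift U[i] t) (shift U[i] A) := by
  ext v
  rw [mem_shift, List.singleton_append, cons_mem_rizzolo h]
  simp [hi]

lemma IsTree.finite_rightSet {t : Set Vertex} (ht : IsTree t) (u : Vertex) :
    (rightSet t u).Finite := by
  have hfin : {w : Vertex | w <+: u}.Finite := by
    refine (List.finite_toSet u.inits).subset fun w hw => ?_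
    simpa using hw
  refine (hfin.biUnion (t := fun w => MarkedGW.children t w) fun w _ => ?_).subset ?_
  · by_cases hw : w ∈ t
    · obtain ⟨k, hk⟩ := ht.children w hw
      refine (Set.finite_range fun i : Fin k => w ++ [Nat.succPNat i]).subset ?_
      rintro _ ⟨hv, i, rfl⟩
      have := (hk i).1 hv
      have := i.natPred_add_one
      exact ⟨⟨i.natPred, by omega⟩, by simp⟩
    · convert Set.finite_empty
      ext v
      simp only [MarkedGW.children, Set.mem_ofPred_eq, Set.mem_empty_iff_false, iff_false]
      rintro ⟨hv, i, rfl⟩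
      exact hw (ht.ancestor_mem _ hv _ (List.prefix_append _ _))
  · rintro v ⟨w, hw, hv, _⟩
    exact Set.mem_biUnion hw hv

lemma IsTree.exists_isRightList {t A : Set Vertex} (ht : IsTree t) {u₀ : Vertex}
    (h : IsLeast A u₀) : ∃ U, IsRightList t A U := by
  have hfin : (rightSetOf t A u₀).Finite :=
    (ht.finite_rightSet u₀).subset fun v hv => hv.1
  refine ⟨hfin.toFinset.sort (· ≤ ·), u₀, h, ?_, fun v => by simp⟩
  exact (Finset.sortedLT_sort _).pairwise

lemma rightSetOf_subset {t A : Set Vertex} {u v : Vertex} (h : v ∈ rightSetOf t A u) : v ∈ t := by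
  obtain ⟨⟨w, _, hv, _⟩, _⟩ := h
  exact hv.1

lemma IsRightList.getElem_mem {t A : Set Vertex} {U : List Vertex} (h : IsRightList t A U) {i : ℕ}
    (hi : i < U.length) : U[i] ∈ t := by
  obtain ⟨u₀, _, _, hmem⟩ := h
  exact rightSetOf_subset ((hmem _).1 (List.getElem_mem hi))

lemma rizzolo_ancestor {t : Set Vertex} (ht : IsTree t) (A : Set Vertex) {u v : Vertex}
    (hu : u ∈ rizzolo t A) (hv : v <+: u) : v ∈ rizzolo t A := by
  induction v generalizing t A u with
  | nil => simp
  | cons i v ih =>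
    obtain ⟨u, rfl⟩ : ∃ u', u = i :: u' := by
      obtain ⟨r, rfl⟩ := hv
      exact ⟨v ++ r, rfl⟩
    have hv' : v <+: u := by simpa using hv
    by_cases h : ∃ u₀, IsLeast A u₀
    · obtain ⟨u₀, h⟩ := h
      obtain ⟨U, hU⟩ := ht.exists_isRightList h
      rw [cons_mem_rizzolo hU] at hu ⊢
      obtain ⟨hi, hu⟩ := hu
      exact ⟨hi, ih (ht.shift (hU.getElem_mem hi)) _ hu hv'⟩
    · exact absurd hu (cons_notMem_rizzolo h i u)

lemma rizzolo_children {t : Set Vertex} (ht : IsTree t) (A : Set Vertex) {u : Vertex}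
    (hu : u ∈ rizzolo t A) : ∃ k : ℕ, ∀ i : ℕ+, u ++ [i] ∈ rizzolo t A ↔ (i : ℕ) ≤ k := by
  induction u generalizing t A with
  | nil =>
    by_cases h : ∃ u₀, IsLeast A u₀
    · obtain ⟨u₀, h⟩ := h
      obtain ⟨U, hU⟩ := ht.exists_isRightList h
      refine ⟨U.length, fun i => ?_⟩
      rw [List.nil_append, cons_mem_rizzolo hU]
      have hi := i.natPred_add_one
      simp only [nil_mem_rizzolo, exists_prop, and_true]
      omega
    · refine ⟨0, fun i => ?_⟩
      simp [cons_notMem_rizzolo h i []]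
  | cons j u ih =>
    by_cases h : ∃ u₀, IsLeast A u₀
    · obtain ⟨u₀, h⟩ := h
      obtain ⟨U, hU⟩ := ht.exists_isRightList h
      rw [cons_mem_rizzolo hU] at hu
      obtain ⟨hj, hu⟩ := hu
      obtain ⟨k, hk⟩ := ih (ht.shift (hU.getElem_mem hj)) _ hu
      refine ⟨k, fun i => ?_⟩
      rw [List.cons_append, cons_mem_rizzolo hU, ← hk]
      simp [hj]
    · exact absurd hu (cons_notMem_rizzolo h j u)

/-- `IsGWTree` requires a tree at every sample point, also where the tree is infinite or carries no
mark; hence neither finiteness of `t` nor a condition on `A`. -/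
lemma isTree_rizzolo {t : Set Vertex} (ht : IsTree t) (A : Set Vertex) : IsTree (rizzolo t A) where
  root_mem := nil_mem_rizzolo t A
  ancestor_mem _ hu _ hv := rizzolo_ancestor ht A hu hv
  children _ hu := rizzolo_children ht A hu

lemma rightSetOf_nil {t A : Set Vertex} {v : Vertex} : v ∈ rightSetOf t A [] ↔
    ∃ i : ℕ+, v = [i] ∧ [i] ∈ t ∧ (shift [i] A).Nonempty := by
  simp only [rightSetOf, rightSet, children, Set.mem_ofPred_eq, List.prefix_nil]
  constructor
  · rintro ⟨⟨w, rfl, ⟨hv, i, rfl⟩, _⟩, a, ha, r, rfl⟩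
    exact ⟨i, rfl, hv, r, ha⟩
  · rintro ⟨i, rfl, hi, r, hr⟩
    exact ⟨⟨[], rfl, ⟨hi, i, rfl⟩, List.nil_lt_cons _ _⟩, _, hr, List.prefix_append _ _⟩

/-- The parent of `v` is an ancestor of `i :: u`. Either it is the root and `v` is a later sibling
of `i`, or it begins with `i` and everything takes place in the subtree above `i`. -/
lemma rightSetOf_cons {t A : Set Vertex} {i : ℕ+} {u v : Vertex} (hi : [i] ∈ t) :
    v ∈ rightSetOf t A (i :: u) ↔
    (∃ w, v = i :: w ∧ w ∈ rightSetOf (shift [i] t) (shift [i] A) u) ∨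
    ∃ j : ℕ+, i < j ∧ v = [j] ∧ [j] ∈ t ∧ (shift [j] A).Nonempty := by
  simp only [rightSetOf, rightSet, children, Set.mem_ofPred_eq]
  constructor
  · rintro ⟨⟨w, hw, ⟨hv, j, rfl⟩, hlt⟩, a, ha, r, rfl⟩
    cases w with
    | nil =>
      have : i < j := by simpa [List.cons_lt_cons_iff] using hlt
      exact Or.inr ⟨j, this, rfl, hv, r, ha⟩
    | cons k w =>
      obtain ⟨rfl, hwu⟩ : k = i ∧ w <+: u := by simpa [List.cons_prefix_cons] using hw
      refine Or.inl ⟨w ++ [j], rfl, ⟨w, hwu, ⟨hv, j, rfl⟩, ?_⟩, w ++ [j] ++ r, ha, r, rfl⟩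
      simpa [List.cons_lt_cons_iff] using hlt
  · rintro (⟨w, rfl, ⟨x, hx, ⟨hw, j, rfl⟩, hlt⟩, a, ha, r, rfl⟩ | ⟨j, hij, rfl, hj, r, hr⟩)
    · refine ⟨⟨i :: x, by simpa [List.cons_prefix_cons] using hx, ⟨hw, j, rfl⟩, ?_⟩, _, ha, r, rfl⟩
      simpa [List.cons_lt_cons_iff] using hlt
    · refine ⟨⟨[], List.nil_prefix, ⟨hj, j, rfl⟩, ?_⟩, _, hr, List.prefix_append _ _⟩
      simp [List.cons_lt_cons_iff, hij]

lemma isLeast_nil {A : Set Vertex} (h : [] ∈ A) : IsLeast A [] :=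
  ⟨h, fun v _ => by cases v with
    | nil => exact le_rfl
    | cons i v => exact (List.nil_lt_cons i v).le⟩

lemma isLeast_cons {A : Set Vertex} {i : ℕ+} {u : Vertex} (h0 : [] ∉ A)
    (hu : IsLeast (shift [i] A) u) (hj : ∀ j < i, ¬ (shift [j] A).Nonempty) :
    IsLeast A (i :: u) := by
  refine ⟨hu.1, fun v hv => ?_⟩
  cases v with
  | nil => exact absurd hv h0
  | cons j v =>
    rw [← not_lt, List.cons_lt_cons_iff]
    rintro (h | ⟨rfl, h⟩)
    · exact hj j h ⟨v, hv⟩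
    · exact absurd (hu.2 hv) (not_le.2 h)

/-! ### Finite marked trees -/

/-- Finite ordered trees with marks on the vertices. -/
inductive MTree : Type
  | node (b : Bool) (n : ℕ) (c : Fin n → MTree) : MTree

namespace MTree

/-- Membership of a vertex in the tree. -/
def VMem : MTree → Vertex → Prop
  | node _ _ _, [] => True
  | node _ n c, i :: v => ∃ h : i.natPred < n, VMem (c ⟨i.natPred, h⟩) v

/-- Membership of a vertex in the set of marked vertices. -/
def MMem : MTree → Vertex → Prop
  | node b _ _, [] => b = true
  | node _ n c, i :: v => ∃ h : i.natPred < n, MMem (c ⟨i.natPred, h⟩) v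

/-- The set of vertices. -/
def vset (m : MTree) : Set Vertex := {v | VMem m v}

/-- The set of marked vertices. -/
def mset (m : MTree) : Set Vertex := {v | MMem m v}

/-- The tree has a marked vertex. -/
def Marked : MTree → Prop
  | node b _ c => b = true ∨ ∃ i, Marked (c i)

@[simp] lemma nil_mem_vset (m : MTree) : [] ∈ vset m := by
  cases m; simp [vset, VMem]

@[simp] lemma nil_mem_mset {b : Bool} {n : ℕ} {c : Fin n → MTree} :
    [] ∈ mset (node b n c) ↔ b = true := by
  simp [mset, MMem]

lemma cons_mem_vset {b : Bool} {n : ℕ} {c : Fin n → MTree} {i : ℕ+} {v : Vertex} :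
    i :: v ∈ vset (node b n c) ↔ ∃ h : i.natPred < n, v ∈ vset (c ⟨i.natPred, h⟩) := by
  simp [vset, VMem]

lemma cons_mem_mset {b : Bool} {n : ℕ} {c : Fin n → MTree} {i : ℕ+} {v : Vertex} :
    i :: v ∈ mset (node b n c) ↔ ∃ h : i.natPred < n, v ∈ mset (c ⟨i.natPred, h⟩) := by
  simp [mset, MMem]

lemma shift_vset {b : Bool} {n : ℕ} {c : Fin n → MTree} (i : Fin n) :
    shift [Nat.succPNat i] (vset (node b n c)) = vset (c i) := by
  ext v
  rw [mem_shift, List.singleton_append, cons_mem_vset]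
  simp

lemma shift_mset {b : Bool} {n : ℕ} {c : Fin n → MTree} (i : Fin n) :
    shift [Nat.succPNat i] (mset (node b n c)) = mset (c i) := by
  ext v
  rw [mem_shift, List.singleton_append, cons_mem_mset]
  simp

lemma singleton_mem_vset {b : Bool} {n : ℕ} {c : Fin n → MTree} {i : ℕ+} :
    [i] ∈ vset (node b n c) ↔ (i : ℕ) ≤ n := by
  rw [cons_mem_vset]
  have hi := i.natPred_add_one
  simp only [nil_mem_vset, exists_prop, and_true]
  omega

lemma outDegree_vset {b : Bool} {n : ℕ} {c : Fin n → MTree} :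
    outDegree (vset (node b n c)) [] = n :=
  outDegree_eq fun _ => singleton_mem_vset

lemma mset_nonempty {m : MTree} : (mset m).Nonempty ↔ Marked m := by
  induction m with
  | node b n c ih =>
    rw [Marked]
    simp only [← ih]
    constructor
    · rintro ⟨v, hv⟩
      cases v with
      | nil => exact Or.inl (nil_mem_mset.1 hv)
      | cons i v =>
        obtain ⟨h, hv⟩ := cons_mem_mset.1 hv
        exact Or.inr ⟨_, v, hv⟩
    · rintro (h | ⟨i, v, hv⟩)
      · exact ⟨[], nil_mem_mset.2 h⟩
      · refine ⟨Nat.succPNat i :: v, ?_⟩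
        rw [← shift_mset (b := b)] at hv
        exact hv

open Classical in
/-- The list of subtrees at the elements of `R_{u₀}^A`, where `A` is the set of marked vertices and
`u₀` its smallest element. -/
noncomputable def parts : MTree → List MTree
  | node true n c => ((List.finRange n).filter fun i => Marked (c i)).map c
  | node false n c =>
    match (List.finRange n).filter fun i => Marked (c i) with
    | [] => []
    | i :: r => parts (c i) ++ r.map c

lemma mset_subset_vset (m : MTree) : mset m ⊆ vset m := by
  intro v hv
  induction v generalizing m with
  | nil => simp
  | cons i v ih =>
    obtain ⟨b, n, c⟩ := m
    obtain ⟨h, hv⟩ := cons_mem_mset.1 hv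
    exact cons_mem_vset.2 ⟨h, ih _ hv⟩

/-- If the root is marked, it is u₀, and the right vertices are the children whose subtree carries a
mark. Otherwise u₀ lies above the first such child, and the right vertices are those found in its
subtree, followed by the later such children. This is the recursion of `parts`. -/
lemma exists_rightList {m : MTree} (hm : Marked m) : ∃ U, IsRightList (vset m) (mset m) U ∧
    U.map (fun u => (shift u (vset m), shift u (mset m))) =
      (parts m).map fun m' => (vset m', mset m') := by
  classical
  induction m with
  | node b n c ih =>
  have hsort : (List.finRange n).Pairwise (· < ·) := List.pairwise_lt_finRange n
  have hchild : ∀ i : Fin n, (shift [Nat.succPNat i] (vset (node b n c)),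
      shift [Nat.succPNat i] (mset (node b n c))) = (vset (c i), mset (c i)) := fun i => by
    rw [shift_vset, shift_mset]
  have hmarked : ∀ j : ℕ+, ([j] ∈ vset (node b n c) ∧ (shift [j] (mset (node b n c))).Nonempty) ↔
      ∃ i : Fin n, j = Nat.succPNat i ∧ Marked (c i) := by
    intro j
    have hj := j.natPred_add_one
    constructor
    · rintro ⟨h1, h2⟩
      rw [singleton_mem_vset] at h1
      refine ⟨⟨j.natPred, by omega⟩, by simp, ?_⟩
      rw [← mset_nonempty, ← shift_mset (b := b)]
      simpa using h2
    · rintro ⟨i, rfl, hi⟩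
      rw [singleton_mem_vset, shift_mset, mset_nonempty]
      exact ⟨by simp only [Nat.succPNat_coe]; omega, hi⟩
  cases b with
  | true =>
    refine ⟨((List.finRange n).filter fun i => Marked (c i)).map fun i : Fin n => [Nat.succPNat i],
      ⟨[], isLeast_nil (by simp), ?_, fun v => ?_⟩, ?_⟩
    · rw [List.pairwise_map]
      refine (hsort.filter _).imp fun {i j} h => ?_
      rw [List.cons_lt_cons_iff]
      exact Or.inl (Nat.succPNat_lt_succPNat.2 h)
    · rw [rightSetOf_nil]
      simp only [hmarked, List.mem_map, List.mem_filter, List.mem_finRange, true_and,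
        decide_eq_true_eq]
      constructor
      · rintro ⟨i, hi, rfl⟩
        exact ⟨_, rfl, i, rfl, hi⟩
      · rintro ⟨_, rfl, i, rfl, hi⟩
        exact ⟨i, hi, rfl⟩
    · rw [parts, List.map_map, List.map_map]
      exact List.map_congr_left fun i _ => hchild i
  | false =>
    have hex : ∃ i, Marked (c i) := by simpa [Marked] using hm
    rcases hf : (List.finRange n).filter fun i => Marked (c i) with _ | ⟨i, r⟩
    · obtain ⟨i, hi⟩ := hex
      have : i ∈ (List.finRange n).filter fun i => Marked (c i) := by simp [hi]
      simp [hf] at this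
    · have hir : ∀ j, j ∈ i :: r ↔ Marked (c j) := fun j => by
        rw [← hf]; simp
      have hpw : (i :: r).Pairwise (· < ·) := hf ▸ hsort.filter _
      rw [List.pairwise_cons] at hpw
      have hi : Marked (c i) := (hir i).1 (by simp)
      obtain ⟨U, ⟨u₀, hu₀, hU, hmem⟩, hmap⟩ := ih i hi
      refine ⟨U.map (fun u => Nat.succPNat i :: u) ++ r.map fun j : Fin n => [Nat.succPNat j],
        ⟨Nat.succPNat i :: u₀, isLeast_cons (by simp) (by rwa [shift_mset]) ?_, ?_, fun v => ?_⟩, ?_⟩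
      -- No earlier child carries a mark, because `i` heads the sorted list of those that do.
      · intro j hj hne
        have : [j] ∈ vset (node false n c) := by
          obtain ⟨v, hv⟩ := hne
          rw [mem_shift, List.singleton_append, cons_mem_mset] at hv
          exact cons_mem_vset.2 ⟨hv.1, by simp⟩
        obtain ⟨k, rfl, hk⟩ := (hmarked j).1 ⟨this, hne⟩
        have hki : k < i := Nat.succPNat_lt_succPNat.1 hj
        rcases List.mem_cons.1 ((hir k).2 hk) with rfl | h
        · exact lt_irrefl _ hki
        · exact lt_asymm hki (hpw.1 k h)
      · rw [List.pairwise_append]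
        refine ⟨?_, ?_, ?_⟩
        · rw [List.pairwise_map]
          exact hU.imp fun {u v} h => List.cons_lt_cons_iff.2 (Or.inr ⟨rfl, h⟩)
        · rw [List.pairwise_map]
          refine hpw.2.imp fun {i j} h => ?_
          rw [List.cons_lt_cons_iff]
          exact Or.inl (Nat.succPNat_lt_succPNat.2 h)
        · simp only [List.mem_map]
          rintro _ ⟨u, _, rfl⟩ _ ⟨j, hj, rfl⟩
          exact List.cons_lt_cons_iff.2 (Or.inl (Nat.succPNat_lt_succPNat.2 (hpw.1 j hj)))
      · rw [rightSetOf_cons (by rw [singleton_mem_vset]; simp only [Nat.succPNat_coe]; omega),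
          shift_vset, shift_mset]
        simp only [hmarked, List.mem_append, List.mem_map, hmem]
        refine or_congr ⟨?_, ?_⟩ ⟨?_, ?_⟩
        · rintro ⟨u, hu, rfl⟩
          exact ⟨u, rfl, hu⟩
        · rintro ⟨u, rfl, hu⟩
          exact ⟨u, hu, rfl⟩
        · rintro ⟨j, hj, rfl⟩
          exact ⟨_, Nat.succPNat_lt_succPNat.2 (hpw.1 j hj), rfl, j, rfl,
            (hir j).1 (List.mem_cons_of_mem _ hj)⟩
        · rintro ⟨_, hlt, rfl, j, rfl, hj⟩
          refine ⟨j, ?_, rfl⟩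
          rcases List.mem_cons.1 ((hir j).2 hj) with rfl | h
          · exact absurd hlt (lt_irrefl _)
          · exact h
      · rw [parts, hf]
        simp only [List.map_append, List.map_map]
        congr 1
        · rw [← hmap]
          refine List.map_congr_left fun u _ => ?_
          simp only [Function.comp_apply]
          rw [shift_cons, shift_cons _ _ (mset _), shift_vset, shift_mset]
        · exact List.map_congr_left fun j _ => hchild j

lemma outDegree_rizzolo {m : MTree} (hm : Marked m) :
    outDegree (rizzolo (vset m) (mset m)) [] = (parts m).length := by
  obtain ⟨U, hU, hmap⟩ := exists_rightList hm
  rw [rizzolo_outDegree hU, ← List.length_map, hmap, List.length_map]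

lemma shift_rizzolo {m : MTree} (hm : Marked m) (i : ℕ) (hi : i < (parts m).length) :
    shift [Nat.succPNat i] (rizzolo (vset m) (mset m)) =
      rizzolo (vset (parts m)[i]) (mset (parts m)[i]) := by
  obtain ⟨U, hU, hmap⟩ := exists_rightList hm
  have hlen : U.length = (parts m).length := by
    rw [← List.length_map, hmap, List.length_map]
  rw [MarkedGW.shift_rizzolo hU i (by omega)]
  have := List.getElem_of_eq hmap (i := i) (by simp; omega)
  simp only [List.getElem_map, Prod.mk.injEq] at this
  rw [this.1, this.2]

end MTree

/-! ### Sums over trees and forests -/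

lemma tsum_pi_prod {α : Type*} {n : ℕ} (f : Fin n → α → ℝ≥0∞) :
    ∑' c : Fin n → α, ∏ i, f i (c i) = ∏ i, ∑' a, f i a := by
  induction n with
  | zero => simp
  | succ n ih =>
    rw [← (Fin.consEquiv fun _ : Fin (n + 1) => α).tsum_eq, ENNReal.tsum_prod', Fin.prod_univ_succ,
      ← ih, ← ENNReal.tsum_mul_right]
    refine tsum_congr fun a => ?_
    rw [← ENNReal.tsum_mul_left]
    refine tsum_congr fun c => ?_
    simp [Fin.consEquiv, Fin.prod_univ_succ]

lemma tsum_list {α : Type*} (f : List α → ℝ≥0∞) :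
    ∑' l, f l = f [] + ∑' a, ∑' l, f (a :: l) := by
  let e : Unit ⊕ (α × List α) ≃ List α :=
    { toFun := fun o => o.elim (fun _ => []) fun x => x.1 :: x.2
      invFun := fun l => match l with
        | [] => Sum.inl ()
        | a :: l => Sum.inr (a, l)
      left_inv := by rintro (_ | ⟨a, l⟩) <;> rfl
      right_inv := by rintro (_ | ⟨a, l⟩) <;> rfl }
  rw [← e.tsum_eq, ENNReal.summable.tsum_sum ENNReal.summable, ENNReal.tsum_prod',
    tsum_fintype, Fintype.sum_unique]
  rfl

namespace MTree

/-- The decomposition of a tree at its root. -/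
def rootEquiv : (Bool × Σ n : ℕ, Fin n → MTree) ≃ MTree where
  toFun x := node x.1 x.2.1 x.2.2
  invFun | node b n c => (b, ⟨n, c⟩)
  left_inv _ := rfl
  right_inv := by rintro ⟨b, n, c⟩; rfl

lemma tsum_eq (f : MTree → ℝ≥0∞) :
    ∑' m, f m = ∑' b, ∑' n, ∑' c, f (node b n c) := by
  rw [← rootEquiv.tsum_eq, ENNReal.tsum_prod']
  refine tsum_congr fun b => ?_
  rw [ENNReal.tsum_sigma']
  rfl

/-- The weight of a tree: the product over its vertices of `w b k`, with `b` the mark and `k` the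
number of children. -/
noncomputable def weight (w : Bool → ℕ → ℝ≥0∞) : MTree → ℝ≥0∞
  | node b n c => w b n * ∏ i, weight w (c i)

/-- Decomposition at the root: the total mass is a fixed point of the generating function of the
offspring weights, with the mark summed out. -/
lemma tsum_weight (w : Bool → ℕ → ℝ≥0∞) :
    ∑' m, weight w m = ∑' n, (w true n + w false n) * (∑' m, weight w m) ^ n := by
  conv_lhs => rw [tsum_eq]
  rw [tsum_bool, ← ENNReal.tsum_add]
  refine tsum_congr fun n => ?_
  simp only [weight, ENNReal.tsum_mul_left]
  rw [tsum_pi_prod, Finset.prod_const, Finset.card_univ, Fintype.card_fin]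
  ring

end MTree

/-! ### Extinction: fixed points of a critical generating function -/

lemma one_add_mul_sub_one_lt_pow {x : ℝ} (hx0 : 0 ≤ x) (hx1 : x < 1) (n : ℕ) :
    1 + ((n + 2 : ℕ) : ℝ) * (x - 1) < x ^ (n + 2) := by
  have h := one_add_mul_le_pow (a := x - 1) (by linarith) (n + 1)
  have h2 := mul_le_mul_of_nonneg_left h hx0
  have h3 : x * (1 + (x - 1)) ^ (n + 1) = x ^ (n + 2) := by ring
  have hn : (0 : ℝ) ≤ n := n.cast_nonneg
  push_cast at h2 ⊢
  -- Bernoulli's inequality with exponent `n + 1`, multiplied by `x`, leaves a gap of `(n + 1) (x -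
  -- 1) ^ 2`.
  nlinarith [mul_pos (show (0 : ℝ) < n + 1 by positivity) (pow_pos (sub_pos.2 hx1) 2)]

lemma sum_singleton (p : Measure ℕ) [IsProbabilityMeasure p] : ∑' n, p {n} = 1 := by
  rw [← Measure.tsum_indicator_apply_singleton p Set.univ MeasurableSet.univ |>.trans measure_univ]
  simp

lemma mean_eq_tsum (p : Measure ℕ) : mean p = ∑' n : ℕ, (n : ℝ≥0∞) * p {n} := by
  rw [mean, lintegral_countable']

lemma hasSum_toReal_of_tsum_eq {f : ℕ → ℝ≥0∞} {a : ℝ≥0∞} (h : ∑' n, f n = a) (ha : a ≠ ∞) :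
    HasSum (fun n => (f n).toReal) a.toReal := by
  rw [← h] at ha ⊢
  rw [ENNReal.tsum_toReal_eq fun n => ENNReal.ne_top_of_tsum_ne_top ha n]
  exact ENNReal.hasSum_toReal ha

/-- The generating function of a critical offspring distribution has no fixed point in `[0, 1)`. -/
lemma eq_one_of_fixed_point {p : Measure ℕ} (hp : IsOffspringLaw p) (hcrit : mean p = 1)
    {e : ℝ≥0∞} (he : e ≤ 1) (hfix : e = ∑' n, p {n} * e ^ n) : e = 1 := by
  have := hp.isProbabilityMeasure
  by_contra hne
  have hlt : e < 1 := lt_of_le_of_ne he hne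
  have htop : e ≠ ∞ := (hlt.trans ENNReal.one_lt_top).ne
  have hsum0 := sum_singleton p
  have hsum1 : ∑' n : ℕ, (n : ℝ≥0∞) * p {n} = 1 := by rw [← mean_eq_tsum, hcrit]
  set x := e.toReal with hx
  have hx0 : 0 ≤ x := ENNReal.toReal_nonneg
  have hx1 : x < 1 := by
    rw [hx, ← ENNReal.toReal_one]
    exact ENNReal.toReal_strict_mono ENNReal.one_ne_top hlt
  set r : ℕ → ℝ := fun n => (p {n}).toReal with hr
  have s0 : HasSum r 1 := by
    simpa using hasSum_toReal_of_tsum_eq hsum0 ENNReal.one_ne_top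
  have s1 : HasSum (fun n : ℕ => (n : ℝ) * r n) 1 := by
    simpa [ENNReal.toReal_mul, hr] using hasSum_toReal_of_tsum_eq hsum1 ENNReal.one_ne_top
  have s2 : HasSum (fun n : ℕ => r n * x ^ n) x := by
    simpa [ENNReal.toReal_mul, hr, hx] using hasSum_toReal_of_tsum_eq hfix.symm htop
  -- The Bernoulli gaps are nonnegative, and total mass one, mean one and the fixed point equation
  -- make their average under `p` vanish. Since the gap is strict for exponents at least 2, `p`
  -- would charge only 0 and 1.
  have s3 : HasSum (fun n : ℕ => r n * (x ^ n - (1 + n * (x - 1)))) 0 := by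
    have := s2.sub (s0.add (s1.mul_right (x - 1)))
    rw [show x - (1 + 1 * (x - 1)) = 0 by ring] at this
    have hcongr : (fun n : ℕ => r n * (x ^ n - (1 + n * (x - 1)))) =
        fun n => r n * x ^ n - (r n + n * r n * (x - 1)) := by
      funext n; ring
    rwa [hcongr]
  have hnonneg : ∀ n : ℕ, 0 ≤ r n * (x ^ n - (1 + n * (x - 1))) := fun n => by
    refine mul_nonneg ENNReal.toReal_nonneg ?_
    have := one_add_mul_le_pow (a := x - 1) (by linarith) n
    simp only [add_sub_cancel] at this
    linarith
  have hzero := (hasSum_zero_iff_of_nonneg hnonneg).1 s3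
  have hp2 : ∀ n, p {n + 2} = 0 := fun n => by
    have h1 := congrFun hzero (n + 2)
    have h2 := one_add_mul_sub_one_lt_pow hx0 hx1 n
    simp only [Pi.zero_apply, mul_eq_zero] at h1
    rcases h1 with h1 | h1
    · exact (ENNReal.toReal_eq_zero_iff _).1 h1 |>.resolve_right (measure_ne_top _ _)
    · linarith
  have h01 : p {0} + p {1} = 1 := by
    rw [← hsum0, ← ENNReal.summable.sum_add_tsum_nat_add' (k := 2)]
    simp only [hp2, tsum_zero, add_zero, Finset.sum_range_succ, Finset.sum_range_zero, zero_add]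
  exact absurd hp.zero_add_one_lt (by rw [h01]; exact lt_irrefl 1)

namespace MTree

/-! ### Depth-first exploration of a forest until the first marked vertex -/

/-- One step of the exploration of a forest: if the first root has mark `b`, it is replaced by its
children. -/
def step (b : Bool) : List MTree → Option (List MTree)
  | node b' _ c :: r => if b' = b then some (List.ofFn c ++ r) else none
  | [] => none

/-- The forest after `s` steps, if these have met no marked vertex. -/
def pos : ℕ → List MTree → Option (List MTree)
  | 0, l => some l
  | s + 1, l => (pos s l).bind (step false)

/-- The forest after `s + 1` steps, if the last of these has met the first marked vertex. -/
def hit (s : ℕ) (l : List MTree) : Option (List MTree) := (pos s l).bind (step true)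

/-- The product of the weights of the trees of a forest. -/
noncomputable def fweight (w : Bool → ℕ → ℝ≥0∞) (l : List MTree) : ℝ≥0∞ := (l.map (weight w)).prod

@[simp] lemma fweight_nil (w : Bool → ℕ → ℝ≥0∞) : fweight w [] = 1 := rfl

@[simp] lemma fweight_cons (w : Bool → ℕ → ℝ≥0∞) (m : MTree) (l : List MTree) :
    fweight w (m :: l) = weight w m * fweight w l := by simp [fweight]

lemma fweight_append (w : Bool → ℕ → ℝ≥0∞) (l l' : List MTree) :
    fweight w (l ++ l') = fweight w l * fweight w l' := by simp [fweight]

lemma weight_node (w : Bool → ℕ → ℝ≥0∞) (b : Bool) (n : ℕ) (c : Fin n → MTree) :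
    weight w (node b n c) = w b n * fweight w (List.ofFn c) := by
  simp [weight, fweight, List.map_ofFn, List.prod_ofFn]

lemma ofFn_getElem_take (l : List MTree) (k : Fin (l.length + 1)) :
    List.ofFn (fun i : Fin k => l[(i : ℕ)]'(by omega)) = l.take k := by
  apply List.ext_getElem
  · simp; omega
  · intro i h1 h2
    simp

lemma step_eq_some_iff {b : Bool} {l l' : List MTree} : step b l = some l' ↔
    ∃ n c r, l = node b n c :: r ∧ List.ofFn c ++ r = l' := by
  rcases l with _ | ⟨⟨b', n, c⟩, r⟩
  · simp [step]
  · simp only [step, Option.ite_none_right_eq_some, Option.some.injEq]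
    constructor
    · rintro ⟨rfl, h⟩
      exact ⟨n, c, r, rfl, h⟩
    · rintro ⟨n', c', r', h, h'⟩
      cases h
      exact ⟨rfl, h'⟩

open Classical in
-- A step is undone by choosing how many of the first trees of `l'` to graft on a new root of mark
-- `b`; any number from 0 to `l'.length` is possible, which gives the finite sum.
lemma tsum_step (b : Bool) (g : List MTree → ℝ≥0∞) (l' : List MTree) :
    ∑' l, (if step b l = some l' then g l else 0) =
      ∑ k : Fin (l'.length + 1), g (node b k (fun i => l'[(i : ℕ)]'(by omega)) :: l'.drop k) := by
  set Φ : Fin (l'.length + 1) → List MTree :=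
    fun k => node b k (fun i => l'[(i : ℕ)]'(by omega)) :: l'.drop k with hΦ
  have hinj : Function.Injective Φ := by
    intro k k' h
    simp only [hΦ, List.cons.injEq, MTree.node.injEq] at h
    exact Fin.ext h.1.2.1
  have hstep : ∀ k, step b (Φ k) = some l' := fun k => by
    simp only [hΦ, step, if_true, Option.some.injEq]
    rw [ofFn_getElem_take, List.take_append_drop]
  rw [← hinj.tsum_eq, tsum_fintype]
  · exact Finset.sum_congr rfl fun k _ => by rw [if_pos (hstep k)]
  · intro l hl
    rw [Function.mem_support] at hl
    obtain ⟨n, c, r, rfl, rfl⟩ := step_eq_some_iff.1 (by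
      by_contra h
      exact hl (if_neg h))
    refine ⟨⟨n, by simp⟩, ?_⟩
    simp only [hΦ, List.cons.injEq, MTree.node.injEq, true_and, heq_eq_eq]
    refine ⟨?_, ?_⟩
    · funext i
      rw [List.getElem_append_left (by simp)]
      simp
    · rw [List.drop_append_of_le_length (by simp)]
      simp

end MTree

/-! ### Recursions for the size of the explored forest -/

/-- The effect of one step of the exploration on the law of the size of the forest. -/
noncomputable def walkStep (r v : ℕ → ℝ≥0∞) (h : ℕ) : ℝ≥0∞ :=
  ∑ k ∈ Finset.range (h + 1), r k * v (h - k + 1)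

/-- The law of the size of the forest after `s` unmarked steps. -/
noncomputable def sizeLaw (r : ℕ → ℝ≥0∞) : ℕ → ℕ → ℝ≥0∞
  | 0 => fun h => if h = 1 then 1 else 0
  | s + 1 => walkStep r (sizeLaw r s)

/-- The law of the size of the forest after the first marked vertex. -/
noncomputable def hitLaw (w : Bool → ℕ → ℝ≥0∞) (h : ℕ) : ℝ≥0∞ :=
  ∑' s, walkStep (w true) (sizeLaw (w false) s) h

namespace MTree

open Classical in
lemma ite_bind_eq (o : Option (List MTree)) (f : List MTree → Option (List MTree))
    (y : List MTree) (a : ℝ≥0∞) :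
    (if o.bind f = some y then a else 0) =
      ∑' x, if f x = some y then (if o = some x then a else 0) else 0 := by
  cases o with
  | none => simp
  | some x =>
    rw [tsum_eq_single x]
    · simp
    · intro x' hx'
      simp [hx'.symm]

open Classical in
-- The form `v l.length * fweight w l` expresses that the trees are independent given their number.
-- Undoing a step cuts `l'` into the children of the removed root and the rest; as `fweight` is
-- multiplicative, the form persists and only the law of the size is updated.
lemma tsum_bind_step (w : Bool → ℕ → ℝ≥0∞) (b : Bool) (o : MTree → Option (List MTree))
    (v : ℕ → ℝ≥0∞)
    (h : ∀ l, ∑' m, (if o m = some l then weight w m else 0) = v l.length * fweight w l)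
    (l' : List MTree) :
    ∑' m, (if (o m).bind (step b) = some l' then weight w m else 0) =
      walkStep (w b) v l'.length * fweight w l' := by
  simp_rw [ite_bind_eq]
  rw [ENNReal.tsum_comm]
  have : ∀ l, ∑' m, (if step b l = some l' then if o m = some l then weight w m else 0 else 0) =
      if step b l = some l' then v l.length * fweight w l else 0 := by
    intro l
    split_ifs
    · exact h l
    · simp
  simp_rw [this]
  rw [tsum_step, walkStep, Finset.sum_range fun k => w b k * v (l'.length - k + 1), Finset.sum_mul]
  refine Finset.sum_congr rfl fun k _ => ?_
  rw [fweight_cons, weight_node, ofFn_getElem_take, List.length_cons, List.length_drop]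
  have : fweight w l' = fweight w (l'.take k) * fweight w (l'.drop k) := by
    rw [← fweight_append, List.take_append_drop]
  rw [this]
  ring

open Classical in
lemma tsum_pos (w : Bool → ℕ → ℝ≥0∞) (s : ℕ) (l : List MTree) :
    ∑' m, (if pos s [m] = some l then weight w m else 0) =
      sizeLaw (w false) s l.length * fweight w l := by
  induction s generalizing l with
  | zero =>
    simp only [pos, Option.some.injEq, sizeLaw]
    rcases l with _ | ⟨x, _ | ⟨y, l⟩⟩
    · simp
    · simp
    · simp
  | succ s ih => exact tsum_bind_step w false _ _ ih l

open Classical in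
lemma tsum_hit (w : Bool → ℕ → ℝ≥0∞) (s : ℕ) (l : List MTree) :
    ∑' m, (if hit s [m] = some l then weight w m else 0) =
      walkStep (w true) (sizeLaw (w false) s) l.length * fweight w l :=
  tsum_bind_step w true _ _ (tsum_pos w s) l

/-! ### The parts of a marked tree, followed along the exploration -/

open Classical in
/-- The list of marked trees obtained from a forest by replacing the first marked tree by its
parts. -/
noncomputable def fparts (l : List MTree) : List MTree :=
  match l.filter fun m => Marked m with
  | [] => []
  | m :: r => parts m ++ r

open Classical in
lemma parts_node_true {n : ℕ} {c : Fin n → MTree} :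
    parts (node true n c) = (List.ofFn c).filter fun m => Marked m := by
  rw [parts, List.ofFn_eq_map, List.filter_map]
  rfl

lemma parts_node_false {n : ℕ} {c : Fin n → MTree} :
    parts (node false n c) = fparts (List.ofFn c) := by
  classical
  rw [parts, fparts, List.ofFn_eq_map, List.filter_map]
  have : ((fun m => decide (Marked m)) ∘ c) = fun i => decide (Marked (c i)) := rfl
  rw [this]
  rcases (List.finRange n).filter (fun i => decide (Marked (c i))) with _ | ⟨i, r⟩ <;> rfl

lemma marked_node {b : Bool} {n : ℕ} {c : Fin n → MTree} :
    Marked (node b n c) ↔ b = true ∨ ∃ m ∈ List.ofFn c, Marked m := by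
  simp [Marked, List.mem_ofFn]

open Classical in
lemma fparts_of_step_true {l l' : List MTree} (h : step true l = some l') :
    fparts l = l'.filter fun m => Marked m := by
  obtain ⟨n, c, r, rfl, rfl⟩ := step_eq_some_iff.1 h
  have : Marked (node true n c) := by simp [Marked]
  simp only [fparts, List.filter_cons, this, decide_true, if_true, parts_node_true,
    List.filter_append]

/-- Nothing is lost with an unmarked root: if its tree has a mark, its parts are by definition those
of the forest of its children; otherwise the tree and its children are all filtered out. -/
lemma fparts_of_step_false {l l' : List MTree} (h : step false l = some l') :
    fparts l = fparts l' := by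
  classical
  obtain ⟨n, c, r, rfl, rfl⟩ := step_eq_some_iff.1 h
  have hm := marked_node (b := false) (c := c)
  by_cases h : Marked (node false n c)
  · simp only [fparts, List.filter_cons, h, decide_true, if_true, parts_node_false,
      List.filter_append]
    obtain ⟨m, hm1, hm2⟩ : ∃ m ∈ List.ofFn c, Marked m := by simpa [h] using hm
    have : m ∈ (List.ofFn c).filter fun m => Marked m := by simp [hm1, hm2]
    rcases hf : (List.ofFn c).filter (fun m => Marked m) with _ | ⟨x, r'⟩
    · simp [hf] at this
    · simp
  · have : (List.ofFn c).filter (fun m => Marked m) = [] := by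
      rw [List.filter_eq_nil_iff]
      intro m hm1 hm2
      exact h (hm.2 (Or.inr ⟨m, hm1, by simpa using hm2⟩))
    simp only [fparts, List.filter_cons, h, decide_false, List.filter_append, this]
    simp

lemma marked_of_step_false {l l' : List MTree} (h : step false l = some l') :
    (∃ m ∈ l, Marked m) ↔ ∃ m ∈ l', Marked m := by
  obtain ⟨n, c, r, rfl, rfl⟩ := step_eq_some_iff.1 h
  simp only [List.mem_cons, List.mem_append, or_and_right, exists_or, exists_eq_left, marked_node]
  simp

lemma fparts_of_pos {s : ℕ} {l l' : List MTree} (h : pos s l = some l') :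
    fparts l = fparts l' ∧ ((∃ m ∈ l, Marked m) ↔ ∃ m ∈ l', Marked m) := by
  induction s generalizing l' with
  | zero =>
    cases h
    exact ⟨rfl, Iff.rfl⟩
  | succ s ih =>
    obtain ⟨l₀, h0, h1⟩ := Option.bind_eq_some_iff.1 h
    exact ⟨(ih h0).1.trans (fparts_of_step_false h1), (ih h0).2.trans (marked_of_step_false h1)⟩

open Classical in
lemma fparts_of_hit {s : ℕ} {l l' : List MTree} (h : hit s l = some l') :
    fparts l = (l'.filter fun m => Marked m) ∧ ∃ m ∈ l, Marked m := by
  obtain ⟨l₀, h0, h1⟩ := Option.bind_eq_some_iff.1 h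
  refine ⟨(fparts_of_pos h0).1.trans (fparts_of_step_true h1), (fparts_of_pos h0).2.2 ?_⟩
  obtain ⟨n, c, r, rfl, -⟩ := step_eq_some_iff.1 h1
  exact ⟨_, List.mem_cons_self, by simp [Marked]⟩

lemma fparts_singleton {m : MTree} (h : Marked m) : fparts [m] = parts m := by
  classical
  simp [fparts, h]

/-- The number of vertices. -/
def size : MTree → ℕ
  | node _ _ c => 1 + ∑ i, size (c i)

/-- The number of vertices of a forest. -/
def fsize (l : List MTree) : ℕ := (l.map size).sum

lemma fsize_of_step {b : Bool} {l l' : List MTree} (h : step b l = some l') :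
    fsize l' + 1 = fsize l := by
  obtain ⟨n, c, r, rfl, rfl⟩ := step_eq_some_iff.1 h
  simp [fsize, size, List.map_ofFn, List.sum_ofFn]
  omega

/-- Each step removes one vertex, and a forest with a mark always allows a further step; without a
hit there would be more steps than vertices. -/
lemma exists_hit {l : List MTree} (h : ∃ m ∈ l, Marked m) : ∃ s l', hit s l = some l' := by
  by_contra hno
  push Not at hno
  have key : ∀ s, ∃ l', pos s l = some l' ∧ fsize l' + s = fsize l := by
    intro s
    induction s with
    | zero => exact ⟨l, rfl, rfl⟩
    | succ s ih =>
      obtain ⟨l', hl', hs⟩ := ih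
      obtain ⟨m, hm, -⟩ := (fparts_of_pos hl').2.1 h
      rcases l' with _ | ⟨⟨b, n, c⟩, r⟩
      · simp at hm
      cases b with
      | true =>
        exact absurd (show hit s l = some _ by rw [hit, hl', Option.bind_some, step, if_pos rfl])
          (hno s _)
      | false =>
        have hstep : step false (node false n c :: r) = some (List.ofFn c ++ r) := by
          rw [step, if_pos rfl]
        refine ⟨_, by rw [pos, hl', Option.bind_some, hstep], ?_⟩
        have := fsize_of_step hstep
        omega
  obtain ⟨l', -, h'⟩ := key (fsize l + 1)
  omega

/-- A marked root refuses the unmarked step, so the exploration ends at its first hit; this makes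
the hit unique. -/
lemma pos_eq_none_of_hit {s t : ℕ} {l l' : List MTree} (h : hit s l = some l') (hst : s < t) :
    pos t l = none := by
  induction t, hst using Nat.le_induction with
  | base =>
    obtain ⟨l₀, h0, h1⟩ := Option.bind_eq_some_iff.1 h
    obtain ⟨n, c, r, rfl, -⟩ := step_eq_some_iff.1 h1
    simp [pos, h0, step]
  | succ t _ ih => simp [pos, ih]

lemma hit_unique {s t : ℕ} {l l₁ l₂ : List MTree} (h₁ : hit s l = some l₁)
    (h₂ : hit t l = some l₂) : s = t := by
  rcases lt_trichotomy s t with h | h | h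
  · rw [hit, pos_eq_none_of_hit h₁ h] at h₂
    simp at h₂
  · exact h
  · rw [hit, pos_eq_none_of_hit h₂ h] at h₁
    simp at h₁

open Classical in
-- The exploration of a marked tree has exactly one hit, so a single pair `(s, l)` contributes; an
-- unmarked tree has none.
lemma ite_marked_eq (m : MTree) (a : ℝ≥0∞) (G : List MTree → ℝ≥0∞) :
    (if Marked m then a * G (parts m) else 0) =
      ∑' s, ∑' l, (if hit s [m] = some l then a else 0) * G (l.filter fun m => Marked m) := by
  split_ifs with hm
  · obtain ⟨s, l, h⟩ := exists_hit (l := [m]) ⟨m, by simp, hm⟩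
    rw [tsum_eq_single s, tsum_eq_single l, if_pos h, ← (fparts_of_hit h).1, fparts_singleton hm]
    · intro l' hl'
      rw [h, if_neg (by simpa using hl'.symm), zero_mul]
    · intro t ht
      refine ENNReal.tsum_eq_zero.2 fun l' => ?_
      rw [if_neg fun h' => ht (hit_unique h' h), zero_mul]
  · refine (ENNReal.tsum_eq_zero.2 fun s => ENNReal.tsum_eq_zero.2 fun l => ?_).symm
    rw [if_neg, zero_mul]
    intro h
    obtain ⟨m', h1, h2⟩ := (fparts_of_hit h).2
    simp only [List.mem_singleton] at h1
    exact hm (h1 ▸ h2)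

open Classical in
/-- The parts of a marked tree are the marked trees of a forest that, given its size, is made of
independent trees. -/
lemma tsum_marked_parts (w : Bool → ℕ → ℝ≥0∞) (G : List MTree → ℝ≥0∞) :
    ∑' m, (if Marked m then weight w m * G (parts m) else 0) =
      ∑' l, hitLaw w l.length * fweight w l * G (l.filter fun m => Marked m) := by
  simp_rw [ite_marked_eq]
  rw [ENNReal.tsum_comm]
  have : ∀ s, ∑' m, ∑' l, (if hit s [m] = some l then weight w m else 0) *
        G (l.filter fun m => Marked m) =
      ∑' l : List MTree, walkStep (w true) (sizeLaw (w false) s) l.length * fweight w l *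
        G (l.filter fun m => Marked m) := by
    intro s
    rw [ENNReal.tsum_comm]
    refine tsum_congr fun l => ?_
    rw [ENNReal.tsum_mul_right, tsum_hit]
  simp_rw [this]
  rw [ENNReal.tsum_comm]
  refine tsum_congr fun l => ?_
  rw [ENNReal.tsum_mul_right, ENNReal.tsum_mul_right, hitLaw]

open Classical in
-- The first tree of `l` is either unmarked, which costs a factor `δ`, or the head of `l'`. These
-- two cases are Pascal's rule for the positions of `l'` among `N`.
lemma tsum_length_filter (w : Bool → ℕ → ℝ≥0∞) (N : ℕ) {l' : List MTree}
    (hl' : ∀ m ∈ l', Marked m) :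
    ∑' l, (if l.length = N ∧ (l.filter fun m => Marked m) = l' then fweight w l else 0) =
      (N.choose l'.length : ℝ≥0∞) * (∑' m, if Marked m then 0 else weight w m) ^ (N - l'.length) *
        fweight w l' := by
  set δ := ∑' m, if Marked m then 0 else weight w m with hδ
  induction N generalizing l' with
  | zero =>
    rw [tsum_list]
    rcases l' with _ | ⟨x, l'⟩ <;> simp
  | succ N ih =>
    rw [tsum_list]
    simp only [List.length_nil, (Nat.succ_ne_zero N).symm, false_and, if_false, zero_add,
      List.length_cons, Nat.add_right_cancel_iff, fweight_cons]
    have hunm : ∀ m, ¬ Marked m → ∑' l : List MTree, (if l.length = N ∧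
          ((m :: l).filter fun m => Marked m) = l' then weight w m * fweight w l else 0) =
        weight w m * ((N.choose l'.length : ℝ≥0∞) * δ ^ (N - l'.length) * fweight w l') := by
      intro m hm
      rw [← ih hl', ← ENNReal.tsum_mul_left]
      refine tsum_congr fun l => ?_
      simp [hm]
    rcases l' with _ | ⟨x, l'⟩
    · have : ∀ m, ∑' l : List MTree, (if l.length = N ∧
          ((m :: l).filter fun m => Marked m) = [] then weight w m * fweight w l else 0) =
          (if Marked m then 0 else weight w m) * δ ^ N := by
        intro m
        split_ifs with hm
        · simp [hm]
        · rw [hunm m hm]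
          simp
      simp_rw [this]
      rw [ENNReal.tsum_mul_right, ← hδ]
      simp [pow_succ']
    · have hx : Marked x := hl' x (by simp)
      have hl'' : ∀ m ∈ l', Marked m := fun m hm => hl' m (by simp [hm])
      have : ∀ m, ∑' l : List MTree, (if l.length = N ∧
          ((m :: l).filter fun m => Marked m) = x :: l' then weight w m * fweight w l else 0) =
          (if Marked m then 0 else weight w m) * ((N.choose (l'.length + 1) : ℝ≥0∞) *
            δ ^ (N - (l'.length + 1)) * fweight w (x :: l')) +
          if m = x then (N.choose l'.length : ℝ≥0∞) * δ ^ (N - l'.length) * fweight w (x :: l')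
            else 0 := by
        intro m
        by_cases hm : Marked m
        · rw [if_pos hm, zero_mul, zero_add]
          split_ifs with hmx
          · subst hmx
            rw [fweight_cons, mul_left_comm, ← ih hl'', ← ENNReal.tsum_mul_left]
            refine tsum_congr fun l => ?_
            simp [hm]
          · simp [hm, hmx]
        · rw [if_neg hm, hunm m hm, if_neg (show ¬ m = x by rintro rfl; exact hm hx), add_zero,
            List.length_cons]
      simp_rw [this]
      rw [ENNReal.tsum_add, ENNReal.tsum_mul_right, ← hδ, tsum_ite_eq, List.length_cons,
        Nat.choose_succ_succ, Nat.add_sub_add_right]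
      push_cast
      -- When `N ≤ l'.length` the truncated exponents do not match, but the binomial coefficient in
      -- front vanishes.
      rcases Nat.lt_or_ge l'.length N with h | h
      · rw [show N - l'.length = N - (l'.length + 1) + 1 by omega, pow_succ]
        ring
      · rw [Nat.choose_eq_zero_of_lt (show N < l'.length + 1 by omega)]
        simp

/-- The law of the number of parts of a marked tree, up to a factor for each of them. -/
noncomputable def thinLaw (a : ℕ → ℝ≥0∞) (δ : ℝ≥0∞) (k : ℕ) : ℝ≥0∞ :=
  ∑' N, a N * ((N.choose k : ℝ≥0∞) * δ ^ (N - k))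

open Classical in
-- The forest at the hit is decomposed by its size `N` before thinning. The result is a function of
-- the number of parts times a product over them: given their number, the parts are independent. The
-- missing power of γ appears when each part is normalized.
lemma tsum_parts_eq (w : Bool → ℕ → ℝ≥0∞) (l' : List MTree) :
    ∑' m, (if Marked m ∧ parts m = l' then weight w m else 0) =
      if ∀ m ∈ l', Marked m then
        thinLaw (hitLaw w) (∑' m, if Marked m then 0 else weight w m) l'.length * fweight w l'
      else 0 := by
  have h := tsum_marked_parts w fun l => if l = l' then 1 else 0
  have h1 : ∀ m, (if Marked m then weight w m * (if parts m = l' then 1 else 0) else 0) =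
      if Marked m ∧ parts m = l' then weight w m else 0 := fun m => by
    split_ifs <;> simp_all
  simp_rw [h1] at h
  rw [h]
  split_ifs with hl'
  · have h2 : ∀ l : List MTree, hitLaw w l.length * fweight w l *
        (if (l.filter fun m => Marked m) = l' then 1 else 0) = ∑' N, hitLaw w N *
          if l.length = N ∧ (l.filter fun m => Marked m) = l' then fweight w l else 0 := by
      intro l
      rw [tsum_eq_single l.length]
      · simp
      · intro N hN
        simp [hN.symm]
    simp_rw [h2]
    rw [ENNReal.tsum_comm, thinLaw, ← ENNReal.tsum_mul_right]
    refine tsum_congr fun N => ?_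
    rw [ENNReal.tsum_mul_left, tsum_length_filter w N hl']
    ring
  · refine ENNReal.tsum_eq_zero.2 fun l => ?_
    rw [if_neg, mul_zero]
    rintro rfl
    exact hl' fun m hm => by simpa using (List.mem_filter.1 hm).2

lemma tsum_fweight (w : Bool → ℕ → ℝ≥0∞) (hw : ∑' m, weight w m = 1) (a : ℕ → ℝ≥0∞) :
    ∑' l : List MTree, a l.length * fweight w l = ∑' n, a n := by
  have key : ∀ N, ∑' l : List MTree, (if l.length = N then fweight w l else 0) = 1 := by
    intro N
    induction N with
    | zero =>
      rw [tsum_list]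
      simp
    | succ N ih =>
      rw [tsum_list]
      have : ∀ m, ∑' l : List MTree, (if (m :: l).length = N + 1 then fweight w (m :: l) else 0) =
          weight w m := by
        intro m
        conv_rhs => rw [← mul_one (weight w m), ← ih, ← ENNReal.tsum_mul_left]
        refine tsum_congr fun l => ?_
        simp
      simp_rw [this]
      simp [hw]
  have h2 : ∀ l : List MTree, a l.length * fweight w l = ∑' N, a N *
      if l.length = N then fweight w l else 0 := by
    intro l
    rw [tsum_eq_single l.length]
    · simp
    · intro N hN
      simp [hN.symm]
  simp_rw [h2]
  rw [ENNReal.tsum_comm]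
  refine tsum_congr fun N => ?_
  rw [ENNReal.tsum_mul_left, key, mul_one]

open Classical in
-- With trees of total weight one only the size at the hit matters, so `hitLaw` has for mass the
-- probability of having a mark.
lemma tsum_marked (w : Bool → ℕ → ℝ≥0∞) (hw : ∑' m, weight w m = 1) :
    ∑' m, (if Marked m then weight w m else 0) = ∑' n, hitLaw w n := by
  have h := tsum_marked_parts w fun _ => 1
  simp only [mul_one] at h
  rw [h, tsum_fweight w hw]

/-! ### The law of a marked Galton-Watson tree -/

lemma eq_vset_node_iff {t : Set Vertex} (ht : IsTree t) {b : Bool} {n : ℕ} {c : Fin n → MTree} :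
    t = vset (node b n c) ↔
      outDegree t [] = n ∧ ∀ i : Fin n, shift [Nat.succPNat i] t = vset (c i) := by
  constructor
  · rintro rfl
    exact ⟨outDegree_vset, fun i => shift_vset i⟩
  · rintro ⟨hn, hs⟩
    have hc := (ht.outDegree_root_eq_iff n).1 hn
    ext v
    cases v with
    | nil => simp [ht.root_mem]
    | cons i v =>
      have hi := i.natPred_add_one
      rw [cons_mem_vset]
      constructor
      · intro h
        have h1 : [i] ∈ t := ht.ancestor_mem _ h _ (by simp [List.cons_prefix_cons])
        have h2 : i.natPred < n := by
          have := (hc i).1 h1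
          omega
        refine ⟨h2, ?_⟩
        rw [← hs ⟨_, h2⟩]
        simpa using h
      · rintro ⟨h, hv⟩
        rw [← hs ⟨_, h⟩] at hv
        simpa using hv

lemma ext_sets {m m' : MTree} (hv : vset m = vset m') (hm : mset m = mset m') : m = m' := by
  induction m generalizing m' with
  | node b n c ih =>
    obtain ⟨b', n', c'⟩ := m'
    have hn : n = n' := by
      rw [← outDegree_vset (b := b) (c := c), hv, outDegree_vset]
    subst hn
    have hb : b = b' := by
      have : [] ∈ mset (node b n c) ↔ [] ∈ mset (node b' n c') := by rw [hm]
      rw [nil_mem_mset, nil_mem_mset] at this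
      exact Bool.eq_iff_iff.2 this
    subst hb
    congr 1
    funext i
    refine ih i ?_ ?_
    · rw [← shift_vset (b := b) (c := c), hv, shift_vset]
    · rw [← shift_mset (b := b) (c := c), hm, shift_mset]

lemma vset_node (b : Bool) (n : ℕ) (c : Fin n → MTree) : vset (node b n c) =
    insert [] (⋃ i : Fin n, (fun v => Nat.succPNat i :: v) '' vset (c i)) := by
  ext v
  cases v with
  | nil => simp
  | cons i v =>
    simp only [cons_mem_vset, Set.mem_insert_iff, reduceCtorEq, false_or, Set.mem_iUnion,
      Set.mem_image, List.cons.injEq]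
    constructor
    · rintro ⟨h, hv⟩
      exact ⟨⟨_, h⟩, v, hv, by simp, rfl⟩
    · rintro ⟨j, v, hv, rfl, rfl⟩
      simpa using hv

lemma finite_vset (m : MTree) : (vset m).Finite := by
  induction m with
  | node b n c ih =>
    rw [vset_node]
    exact (Set.finite_iUnion fun i => (ih i).image _).insert _

lemma finprod_vset_node (b : Bool) (n : ℕ) (c : Fin n → MTree) (f : Vertex → ℝ≥0∞) :
    ∏ᶠ u ∈ vset (node b n c), f u =
      f [] * ∏ i : Fin n, ∏ᶠ u ∈ vset (c i), f (Nat.succPNat i :: u) := by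
  rw [vset_node, finprod_mem_insert, finprod_mem_iUnion, finprod_eq_prod_of_fintype]
  · congr 1
    refine Finset.prod_congr rfl fun i _ => ?_
    rw [finprod_mem_image]
    exact fun u _ v _ h => by simpa using h
  · intro i j hij
    rw [Function.onFun, Set.disjoint_left]
    rintro _ ⟨u, _, rfl⟩ ⟨v, _, h⟩
    simp only [List.cons.injEq] at h
    exact hij (Fin.ext (Nat.succPNat_injective h.1.symm))
  · exact fun i => (finite_vset _).image _
  · simp
  · exact Set.finite_iUnion fun i => (finite_vset _).image _

instance : Countable MTree := by
  have : Function.Injective fun m : MTree => ((finite_vset m).toFinset,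
      ((finite_vset m).subset (mset_subset_vset m)).toFinset) := by
    intro m m' h
    simp only [Prod.mk.injEq, Set.Finite.toFinset_inj] at h
    exact ext_sets h.1 h.2
  exact this.countable

/-- The probability that a vertex with `n` children has mark `b`. -/
noncomputable def markProb (q : ℕ → I) (b : Bool) (n : ℕ) : ℝ≥0∞ :=
  if b then ENNReal.ofReal (q n : ℝ) else 1 - ENNReal.ofReal (q n : ℝ)

/-- Independence of the marks yields a product over vertices, whereas `weight` is recursive. `t` and
`A` are variables subject to equations so that the induction can pass to shifted sets. -/
lemma finprod_markProb (q : ℕ → I) (m : MTree) (t A : Set Vertex) (ht : t = vset m)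
    (hA : A = mset m) :
    ∏ᶠ u ∈ vset m, (open Classical in markProb q (decide (u ∈ A)) (outDegree t u)) =
      weight (markProb q) m := by
  classical
  induction m generalizing t A with
  | node b n c ih =>
    rw [finprod_vset_node, weight]
    congr 1
    · rw [ht, outDegree_vset, hA]
      congr 1
      rw [Bool.eq_iff_iff, decide_eq_true_iff, nil_mem_mset]
    · refine Finset.prod_congr rfl fun i _ => ?_
      rw [← ih i (shift [Nat.succPNat i] t) (shift [Nat.succPNat i] A) (by rw [ht, shift_vset])
        (by rw [hA, shift_mset])]
      refine finprod_mem_congr rfl fun u _ => ?_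
      rw [← outDegree_append]
      rfl

lemma weight_mul (w w' : Bool → ℕ → ℝ≥0∞) (m : MTree) :
    weight (fun b n => w b n * w' b n) m = weight w m * weight w' m := by
  induction m with
  | node b n c ih =>
    simp only [weight, ih, Finset.prod_mul_distrib]
    ring

end MTree

/-! ### From weights of finite marked trees to probabilities -/

open MTree

lemma measurable_mem {Ω : Type*} [MeasurableSpace Ω] {A : Ω → Set Vertex} (hA : Measurable A)
    (u : Vertex) : MeasurableSet {ω | u ∈ A ω} :=
  measurableSet_setOfPred.2 (measurable_set_iff.1 hA u)

lemma measurableSet_outDegree {Ω : Type*} [MeasurableSpace Ω] {τ : Ω → Set Vertex}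
    (hτ : Measurable τ) (ht : ∀ ω, IsTree (τ ω)) (n : ℕ) :
    MeasurableSet {ω | outDegree (τ ω) [] = n} := by
  simp only [fun ω => (ht ω).outDegree_root_eq_iff n]
  simp only [Set.ofPred_forall]
  refine MeasurableSet.iInter fun i => ?_
  by_cases hi : (i : ℕ) ≤ n
  · simpa [hi] using measurable_mem hτ [i]
  · simp only [hi, iff_false]
    exact (measurable_mem hτ [i]).compl

lemma measurableSet_eq_set {Ω : Type*} [MeasurableSpace Ω] {A : Ω → Set Vertex}
    (hA : Measurable A) (t : Set Vertex) : MeasurableSet {ω | A ω = t} :=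
  hA (measurableSet_singleton t)

lemma IsGWTree.measure_eq_vset {Ω : Type*} [MeasurableSpace Ω] {P : Measure Ω}
    [IsProbabilityMeasure P] {τ : Ω → Set Vertex} {p : Measure ℕ} (h : IsGWTree P τ p) (m : MTree) :
    P {ω | τ ω = vset m} = weight (fun _ n => p {n}) m := by
  induction m with
  | node b n c ih =>
    set D := {ω | outDegree (τ ω) [] = n} with hD
    have hDm : MeasurableSet D := measurableSet_outDegree h.measurable h.isTree n
    have heq : {ω | τ ω = vset (node b n c)} =
        D ∩ ⋂ i ∈ Finset.univ, (fun ω => shift [Nat.succPNat (i : Fin n)] (τ ω)) ⁻¹'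
          {vset (c i)} := by
      ext ω
      simp [eq_vset_node_iff (h.isTree ω), hD]
    rw [heq, weight, ← h.root_law n]
    by_cases h0 : P D = 0
    · rw [measure_mono_null Set.inter_subset_left h0, h0, zero_mul]
    · rw [← cond_mul_eq_inter hDm, mul_comm,
        (iIndepFun_iff_measure_inter_preimage_eq_mul.1 (h.indep n h0)) Finset.univ
          (sets := fun i => {vset (c i)}) fun i _ => measurableSet_singleton _]
      congr 1
      refine Finset.prod_congr rfl fun i _ => ?_
      rw [← ih i]
      exact (h.identDistrib n h0 i).measure_mem_eq (measurableSet_singleton _)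

lemma IsMarkedGWTree.measure_eq {Ω : Type*} [MeasurableSpace Ω] {P : Measure Ω}
    [IsProbabilityMeasure P] {τ M : Ω → Set Vertex} {p : Measure ℕ} {q : ℕ → I}
    (h : IsMarkedGWTree P τ M p q) (m : MTree) :
    P {ω | τ ω = vset m ∧ M ω = mset m} = weight (fun b n => p {n} * markProb q b n) m := by
  classical
  rw [weight_mul (fun _ n => p {n}) (markProb q), ← h.isGWTree.measure_eq_vset m]
  set D := {ω | τ ω = vset m} with hD
  have hDm : MeasurableSet D := measurableSet_eq_set h.isGWTree.measurable _
  have : {ω | τ ω = vset m ∧ M ω = mset m} = D ∩ {ω | M ω = mset m} := rfl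
  rw [this]
  by_cases h0 : P D = 0
  · rw [measure_mono_null Set.inter_subset_left h0, h0, zero_mul]
  rw [← cond_mul_eq_inter hDm, mul_comm]
  congr 1
  have hfin : Finite (vset m) := finite_vset m
  have := Fintype.ofFinite (vset m)
  have hprob : IsProbabilityMeasure (P[|D]) := cond_isProbabilityMeasure h0
  set E : vset m → Set Ω := fun u =>
    if (u : Vertex) ∈ mset m then {ω | (u : Vertex) ∈ M ω} else {ω | (u : Vertex) ∈ M ω}ᶜ with hE
  have hind := ((iIndepSet_iff_iIndep _ _).1 (h.indep (vset m) h0)).meas_biInter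
    (S := Finset.univ) (s := E) (by
    intro u _
    have : @MeasurableSet _ (MeasurableSpace.generateFrom {{ω | (u : Vertex) ∈ M ω}})
      {ω | (u : Vertex) ∈ M ω} := MeasurableSpace.measurableSet_generateFrom rfl
    simp only [hE]
    split_ifs
    · exact this
    · exact this.compl)
  -- Marks belong to the tree, so on `D` the set of marks need only be tested at the finitely many
  -- vertices of `m`.
  have hset : P[|D] {ω | M ω = mset m} = P[|D] (⋂ u ∈ Finset.univ, E u) := by
    rw [cond_apply hDm, cond_apply hDm]
    congr 2
    ext ω
    simp only [Set.mem_inter_iff, Set.mem_ofPred_eq, Finset.mem_univ, Set.iInter_true,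
      Set.mem_iInter, hD, and_congr_right_iff]
    intro hω
    constructor
    · intro hM u
      simp only [hE]
      split_ifs with hu
      · simpa [hM] using hu
      · simpa [hM] using hu
    · intro hall
      ext u
      by_cases hu : u ∈ vset m
      · have := hall ⟨u, hu⟩
        simp only [hE] at this
        split_ifs at this with h1
        · exact ⟨fun _ => h1, fun _ => this⟩
        · exact ⟨fun h2 => absurd h2 this, fun h2 => absurd h2 h1⟩
      · exact ⟨fun h1 => absurd (hω ▸ h.marks_subset ω h1) hu,
          fun h1 => absurd (mset_subset_vset m h1) hu⟩
  rw [hset, hind, ← finprod_markProb q m _ _ rfl rfl, ← finprod_set_coe_eq_finprod_mem,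
    finprod_eq_prod_of_fintype]
  refine Finset.prod_congr rfl fun u _ => ?_
  have hu := h.prob (vset m) h0 u u.2
  simp only [hE, markProb]
  by_cases hm : (u : Vertex) ∈ mset m
  · simp only [hm, if_true, decide_true]
    exact hu
  · simp only [hm, if_false, decide_false, Bool.false_eq_true]
    rw [prob_compl_eq_one_sub (measurable_mem h.measurable_marks u)]
    exact congrArg (1 - ·) hu

/-- The weights of a marked Galton-Watson tree. -/
noncomputable def markedWeight (p : Measure ℕ) (q : ℕ → I) (b : Bool) (n : ℕ) : ℝ≥0∞ :=
  p {n} * markProb q b n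

lemma markedWeight_add (p : Measure ℕ) (q : ℕ → I) (n : ℕ) :
    markedWeight p q true n + markedWeight p q false n = p {n} := by
  have : ENNReal.ofReal (q n : ℝ) ≤ 1 := by
    rw [← ENNReal.ofReal_one]
    exact ENNReal.ofReal_le_ofReal (q n).2.2
  simp only [markedWeight, markProb, if_true, Bool.false_eq_true, if_false]
  rw [← mul_add, add_tsub_cancel_of_le this, mul_one]

lemma measurableSet_eq_sets {Ω : Type*} [MeasurableSpace Ω] {P : Measure Ω} {p : Measure ℕ}
    {q : ℕ → I} {τ M : Ω → Set Vertex} (h : IsMarkedGWTree P τ M p q) (m : MTree) :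
    MeasurableSet {ω | τ ω = vset m ∧ M ω = mset m} :=
  (measurableSet_eq_set h.isGWTree.measurable _).inter (measurableSet_eq_set h.measurable_marks _)

lemma pairwise_disjoint_eq_sets {Ω : Type*} {τ M : Ω → Set Vertex} :
    Pairwise (Function.onFun Disjoint fun m => {ω | τ ω = vset m ∧ M ω = mset m}) := by
  intro m m' hne
  rw [Function.onFun, Set.disjoint_left]
  rintro ω ⟨h1, h2⟩ ⟨h3, h4⟩
  exact hne (ext_sets (h1.symm.trans h3) (h2.symm.trans h4))

section Law

variable {Ω : Type*} [MeasurableSpace Ω] {P : Measure Ω} [IsProbabilityMeasure P]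
  {p : Measure ℕ} {q : ℕ → I} {τ M : Ω → Set Vertex}

lemma IsMarkedGWTree.measure_iUnion (h : IsMarkedGWTree P τ M p q) :
    P (⋃ m, {ω | τ ω = vset m ∧ M ω = mset m}) = ∑' m, weight (markedWeight p q) m := by
  rw [MeasureTheory.measure_iUnion pairwise_disjoint_eq_sets (measurableSet_eq_sets h)]
  exact tsum_congr fun m => h.measure_eq m

/-- A critical Galton-Watson tree is almost surely finite. -/
lemma IsMarkedGWTree.tsum_weight_eq_one (h : IsMarkedGWTree P τ M p q) (hp : IsOffspringLaw p)
    (hcrit : mean p = 1) : ∑' m, weight (markedWeight p q) m = 1 := by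
  refine eq_one_of_fixed_point hp hcrit ?_ ?_
  · rw [← h.measure_iUnion]
    exact prob_le_one
  · conv_lhs => rw [tsum_weight]
    simp_rw [markedWeight_add]

open Classical in
-- Countably many measurable atoms carry the full mass, so `E` may be any predicate, without
-- measurability.
lemma IsMarkedGWTree.measure_setOf (h : IsMarkedGWTree P τ M p q) (hp : IsOffspringLaw p)
    (hcrit : mean p = 1) (E : Set Vertex → Set Vertex → Prop) :
    P {ω | E (τ ω) (M ω)} =
      ∑' m, if E (vset m) (mset m) then weight (markedWeight p q) m else 0 := by
  have hU : P (⋃ m, {ω | τ ω = vset m ∧ M ω = mset m})ᶜ = 0 := by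
    rw [prob_compl_eq_zero_iff (MeasurableSet.iUnion (measurableSet_eq_sets h)), h.measure_iUnion,
      h.tsum_weight_eq_one hp hcrit]
  have hE : ∀ m, {ω | E (τ ω) (M ω)} ∩ {ω | τ ω = vset m ∧ M ω = mset m} =
      if E (vset m) (mset m) then {ω | τ ω = vset m ∧ M ω = mset m} else ∅ := by
    intro m
    ext ω
    split_ifs with hm
    · simp only [Set.mem_inter_iff, Set.mem_ofPred_eq, and_iff_right_iff_imp]
      rintro ⟨h1, h2⟩
      rwa [h1, h2]
    · simp only [Set.mem_inter_iff, Set.mem_ofPred_eq, Set.mem_empty_iff_false, iff_false]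
      rintro ⟨h0, h1, h2⟩
      rw [h1, h2] at h0
      exact hm h0
  rw [← measure_inter_conull hU, Set.inter_iUnion, MeasureTheory.measure_iUnion]
  · refine tsum_congr fun m => ?_
    rw [hE]
    split_ifs
    · exact h.measure_eq m
    · exact measure_empty
  · exact fun m m' hne => (pairwise_disjoint_eq_sets hne).mono Set.inter_subset_right
      Set.inter_subset_right
  · intro m
    rw [hE]
    split_ifs
    · exact measurableSet_eq_sets h m
    · exact MeasurableSet.empty

end Law

/-! ### Measurability of Rizzolo's map -/

section Measurability

variable {Ω : Type*} [MeasurableSpace Ω]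

/-- As `ncard` is 0 on infinite sets, only a nonzero value identifies finite sets; the event is then
a countable union over finite sets of vertices. -/
lemma measurableSet_ncard_eq {S : Ω → Set Vertex} (hS : Measurable S) {k : ℕ} (hk : k ≠ 0) :
    MeasurableSet {ω | (S ω).ncard = k} := by
  have : {ω | (S ω).ncard = k} = ⋃ F : {F : Finset Vertex // F.card = k},
      {ω | S ω = (F : Finset Vertex)} := by
    ext ω
    simp only [Set.mem_ofPred_eq, Set.mem_iUnion]
    constructor
    · intro h
      have hfin : (S ω).Finite := Set.finite_of_ncard_ne_zero (by omega)
      exact ⟨⟨hfin.toFinset, by rw [← Set.ncard_eq_toFinset_card _ hfin, h]⟩, by simp⟩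
    · rintro ⟨⟨F, hF⟩, h⟩
      rw [h, Set.ncard_coe_finset, hF]
  rw [this]
  exact MeasurableSet.iUnion fun F => measurableSet_eq_set hS _

lemma measurable_of_mem {S : Ω → Set Vertex} (h : ∀ v, MeasurableSet {ω | v ∈ S ω}) :
    Measurable S :=
  measurable_set_iff.2 fun v => measurableSet_setOfPred.1 (h v)

lemma measurable_shift {A : Ω → Set Vertex} (hA : Measurable A) (u : Vertex) :
    Measurable fun ω => shift u (A ω) :=
  measurable_of_mem fun v => measurable_mem hA (u ++ v)

lemma measurable_rightSetOf {t A : Ω → Set Vertex} (ht : Measurable t) (hA : Measurable A)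
    (u : Vertex) : Measurable fun ω => rightSetOf (t ω) (A ω) u := by
  refine measurable_of_mem fun v => ?_
  have : {ω | v ∈ rightSetOf (t ω) (A ω) u} = {ω | v ∈ t ω} ∩
      {_ω | ∃ w : Vertex, w <+: u ∧ (∃ i : ℕ+, v = w ++ [i]) ∧ u < v} ∩
      ⋃ a : Vertex, {ω | a ∈ A ω} ∩ {_ω | v <+: a} := by
    ext ω
    simp only [rightSetOf, rightSet, children, Set.mem_ofPred_eq, Set.mem_inter_iff, Set.mem_iUnion]
    grind
  rw [this]
  exact ((measurable_mem ht v).inter (MeasurableSet.const _)).inter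
    (MeasurableSet.iUnion fun a => (measurable_mem hA a).inter (MeasurableSet.const _))

lemma measurableSet_isLeast {A : Ω → Set Vertex} (hA : Measurable A) (u : Vertex) :
    MeasurableSet {ω | IsLeast (A ω) u} := by
  have : {ω | IsLeast (A ω) u} = {ω | u ∈ A ω} ∩ ⋂ v : Vertex, {ω | v ∈ A ω}ᶜ ∪ {_ω | u ≤ v} := by
    ext ω
    simp only [IsLeast, lowerBounds, Set.mem_ofPred_eq, Set.mem_inter_iff, Set.mem_iInter,
      Set.mem_union, Set.mem_compl_iff, imp_iff_not_or]
  rw [this]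
  exact (measurable_mem hA u).inter
    (MeasurableSet.iInter fun v => (measurable_mem hA v).compl.union (MeasurableSet.const _))

lemma measurable_rizzolo {t A : Ω → Set Vertex} (ht : Measurable t) (hA : Measurable A) :
    Measurable fun ω => rizzolo (t ω) (A ω) := by
  refine measurable_of_mem fun v => ?_
  induction v generalizing t A with
  | nil => simp
  | cons i v ih =>
    have : {ω | i :: v ∈ rizzolo (t ω) (A ω)} = ⋃ u₀ : Vertex, ⋃ u : Vertex,
        {ω | IsLeast (A ω) u₀} ∩ ({ω | u ∈ rightSetOf (t ω) (A ω) u₀} ∩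
          ({ω | {w | w ∈ rightSetOf (t ω) (A ω) u₀ ∧ w ≤ u}.ncard = (i : ℕ)} ∩
            {ω | v ∈ rizzolo (shift u (t ω)) (shift u (A ω))})) := by
      ext ω
      simp only [rizzolo, rizzoloMem, Set.mem_ofPred_eq, Set.mem_iUnion, Set.mem_inter_iff]
    rw [this]
    refine MeasurableSet.iUnion fun u₀ => MeasurableSet.iUnion fun u => ?_
    refine (measurableSet_isLeast hA u₀).inter
      ((measurable_mem (measurable_rightSetOf ht hA u₀) u).inter
        ((measurableSet_ncard_eq (measurable_of_mem fun w => ?_) i.ne_zero).inter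
          (ih (measurable_shift ht u) (measurable_shift hA u))))
    exact (measurable_mem (measurable_rightSetOf ht hA u₀) w).inter (MeasurableSet.const _)

end Measurability

/-! ### The branching property of the image -/

namespace MTree

lemma rizzolo_children_iff {m : MTree} (hm : Marked m) {n : ℕ} (B : Fin n → Set (Set Vertex)) :
    (outDegree (rizzolo (vset m) (mset m)) [] = n ∧
      ∀ i : Fin n, shift [Nat.succPNat i] (rizzolo (vset m) (mset m)) ∈ B i) ↔
    ∃ c : Fin n → MTree, parts m = List.ofFn c ∧
      ∀ i, rizzolo (vset (c i)) (mset (c i)) ∈ B i := by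
  rw [outDegree_rizzolo hm]
  constructor
  · rintro ⟨rfl, h⟩
    refine ⟨fun i => (parts m)[i], by simp, fun i => ?_⟩
    have := h i
    rwa [shift_rizzolo hm i i.2] at this
  · rintro ⟨c, hc, h⟩
    have hl : (parts m).length = n := by rw [hc, List.length_ofFn]
    refine ⟨hl, fun i => ?_⟩
    rw [shift_rizzolo hm i (by omega)]
    have : (parts m)[(i : ℕ)]'(by omega) = c i := by simp [hc]
    rw [this]
    exact h i

open Classical in
-- This is the branching property before normalization: summing the product form of `tsum_parts_eq`
-- over all lists of `n` parts gives a product of sums.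
lemma tsum_rizzolo_children (w : Bool → ℕ → ℝ≥0∞) {n : ℕ} (B : Fin n → Set (Set Vertex)) :
    ∑' m, (if Marked m ∧ (outDegree (rizzolo (vset m) (mset m)) [] = n ∧
      ∀ i : Fin n, shift [Nat.succPNat i] (rizzolo (vset m) (mset m)) ∈ B i)
        then weight w m else 0) =
      thinLaw (hitLaw w) (∑' m, if Marked m then 0 else weight w m) n *
        ∏ i, ∑' m, if Marked m ∧ rizzolo (vset m) (mset m) ∈ B i then weight w m else 0 := by
  have h1 : ∀ m, (if Marked m ∧ (outDegree (rizzolo (vset m) (mset m)) [] = n ∧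
      ∀ i : Fin n, shift [Nat.succPNat i] (rizzolo (vset m) (mset m)) ∈ B i)
        then weight w m else 0) = ∑' c : Fin n → MTree,
        if ∀ i, rizzolo (vset (c i)) (mset (c i)) ∈ B i then
          (if Marked m ∧ parts m = List.ofFn c then weight w m else 0) else 0 := by
    intro m
    split_ifs with h
    · obtain ⟨hm, h⟩ := h
      rw [rizzolo_children_iff hm] at h
      obtain ⟨c, hc, h⟩ := h
      rw [tsum_eq_single c, if_pos h, if_pos ⟨hm, hc⟩]
      intro c' hc'
      have : ¬ parts m = List.ofFn c' := fun h' => hc' (List.ofFn_injective (h'.symm.trans hc))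
      simp [this]
    · refine (ENNReal.tsum_eq_zero.2 fun c => ?_).symm
      split_ifs with h2 h3
      · exact absurd ⟨h3.1, (rizzolo_children_iff h3.1 B).2 ⟨c, h3.2, h2⟩⟩ h
      · rfl
      · rfl
  simp_rw [h1]
  rw [ENNReal.tsum_comm, ← tsum_pi_prod, ← ENNReal.tsum_mul_left]
  refine tsum_congr fun c => ?_
  by_cases hB : ∀ i, rizzolo (vset (c i)) (mset (c i)) ∈ B i
  · simp only [hB, implies_true, if_true, and_true]
    rw [tsum_parts_eq, List.length_ofFn]
    split_ifs with hm
    · rw [fweight, List.map_ofFn, List.prod_ofFn]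
      congr 1
      refine Finset.prod_congr rfl fun i _ => ?_
      rw [if_pos (hm _ (by simp [List.mem_ofFn]))]
      rfl
    · simp only [List.mem_ofFn, forall_exists_index, forall_apply_eq_imp_iff, not_forall] at hm
      obtain ⟨i, hi⟩ := hm
      rw [Finset.prod_eq_zero (Finset.mem_univ i), mul_zero]
      simp [hi]
  · simp only [hB, if_false, tsum_zero]
    obtain ⟨i, hi⟩ := not_forall.1 hB
    rw [Finset.prod_eq_zero (Finset.mem_univ i), mul_zero]
    simp [hi]

end MTree

section Image

variable {Ω : Type*} [MeasurableSpace Ω] {P : Measure Ω} [IsProbabilityMeasure P]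
  {p : Measure ℕ} {q : ℕ → I} {τ M : Ω → Set Vertex}

lemma measurableSet_nonempty {A : Ω → Set Vertex} (hA : Measurable A) :
    MeasurableSet {ω | (A ω).Nonempty} := by
  have : {ω | (A ω).Nonempty} = ⋃ v, {ω | v ∈ A ω} := by
    ext ω
    simp [Set.Nonempty]
  rw [this]
  exact MeasurableSet.iUnion fun v => measurable_mem hA v

open Classical in
lemma IsMarkedGWTree.measure_nonempty (h : IsMarkedGWTree P τ M p q) (hp : IsOffspringLaw p)
    (hcrit : mean p = 1) : P {ω | (M ω).Nonempty} = ∑' n, hitLaw (markedWeight p q) n := by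
  rw [h.measure_setOf hp hcrit fun _ A => A.Nonempty,
    ← tsum_marked _ (h.tsum_weight_eq_one hp hcrit)]
  simp_rw [mset_nonempty]

open Classical in
lemma IsMarkedGWTree.measure_empty (h : IsMarkedGWTree P τ M p q) (hp : IsOffspringLaw p)
    (hcrit : mean p = 1) : 1 - P {ω | (M ω).Nonempty} =
      ∑' m, if Marked m then 0 else weight (markedWeight p q) m := by
  rw [← prob_compl_eq_one_sub (measurableSet_nonempty h.measurable_marks)]
  have := h.measure_setOf hp hcrit fun _ A => ¬ A.Nonempty
  simp_rw [mset_nonempty, ite_not] at this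
  rw [← this]
  rfl

/-- Turning the `n` sums into conditional probabilities produces `γ ^ n`, the power that `thinLaw`
lacks to be binomial; the factor `γ⁻¹` comes from conditioning the whole tree. -/
lemma IsMarkedGWTree.cond_rizzolo (h : IsMarkedGWTree P τ M p q) (hp : IsOffspringLaw p)
    (hcrit : mean p = 1) (hγ : P {ω | (M ω).Nonempty} ≠ 0) {n : ℕ}
    (B : Fin n → Set (Set Vertex)) :
    P[|{ω | (M ω).Nonempty}] {ω | outDegree (rizzolo (τ ω) (M ω)) [] = n ∧
        ∀ i : Fin n, shift [Nat.succPNat i] (rizzolo (τ ω) (M ω)) ∈ B i} =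
      (P {ω | (M ω).Nonempty})⁻¹ * P {ω | (M ω).Nonempty} ^ n *
        thinLaw (hitLaw (markedWeight p q)) (1 - P {ω | (M ω).Nonempty}) n *
        ∏ i, P[|{ω | (M ω).Nonempty}] {ω | rizzolo (τ ω) (M ω) ∈ B i} := by
  classical
  have hm := measurableSet_nonempty h.measurable_marks
  set γ := P {ω | (M ω).Nonempty} with hγdef
  have hγ' : γ ≠ ∞ := measure_ne_top _ _
  have h2 : ∀ i, P[|{ω | (M ω).Nonempty}] {ω | rizzolo (τ ω) (M ω) ∈ B i} =
      γ⁻¹ * ∑' m, if Marked m ∧ rizzolo (vset m) (mset m) ∈ B i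
        then weight (markedWeight p q) m else 0 := by
    intro i
    rw [cond_apply hm]
    congr 1
    have := h.measure_setOf hp hcrit fun t A => A.Nonempty ∧ rizzolo t A ∈ B i
    simp_rw [mset_nonempty] at this
    exact this
  simp_rw [h2]
  rw [cond_apply hm, Finset.prod_mul_distrib, Finset.prod_const, Finset.card_univ, Fintype.card_fin]
  have h1 := h.measure_setOf hp hcrit fun t A => A.Nonempty ∧ (outDegree (rizzolo t A) [] = n ∧
        ∀ i : Fin n, shift [Nat.succPNat i] (rizzolo t A) ∈ B i)
  simp_rw [mset_nonempty] at h1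
  rw [tsum_rizzolo_children, ← h.measure_empty hp hcrit, ← hγdef] at h1
  have h3 : {ω | (M ω).Nonempty} ∩ {ω | outDegree (rizzolo (τ ω) (M ω)) [] = n ∧
        ∀ i : Fin n, shift [Nat.succPNat i] (rizzolo (τ ω) (M ω)) ∈ B i} =
      {ω | (M ω).Nonempty ∧ (outDegree (rizzolo (τ ω) (M ω)) [] = n ∧
        ∀ i : Fin n, shift [Nat.succPNat i] (rizzolo (τ ω) (M ω)) ∈ B i)} := rfl
  rw [h3, h1]
  have h4 : γ ^ n * γ⁻¹ ^ n = 1 := by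
    rw [← mul_pow, ENNReal.mul_inv_cancel hγ hγ', one_pow]
  set T := thinLaw (hitLaw (markedWeight p q)) (1 - γ) n
  set Q := ∏ i, ∑' m, if Marked m ∧ rizzolo (vset m) (mset m) ∈ B i
        then weight (markedWeight p q) m else 0
  calc γ⁻¹ * (T * Q) = γ⁻¹ * (T * Q) * (γ ^ n * γ⁻¹ ^ n) := by rw [h4, mul_one]
    _ = _ := by ring

/-- A random tree with the branching property is a Galton-Watson tree. -/
lemma isGWTree_of_branching {P : Measure Ω} [IsProbabilityMeasure P] {T : Ω → Set Vertex}
    {ν : Measure ℕ} (hT : Measurable T) (ht : ∀ ω, IsTree (T ω))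
    (h : ∀ (n : ℕ) (B : Fin n → Set (Set Vertex)),
      P {ω | outDegree (T ω) [] = n ∧ ∀ i : Fin n, shift [Nat.succPNat i] (T ω) ∈ B i} =
        ν {n} * ∏ i, P {ω | T ω ∈ B i}) : IsGWTree P T ν := by
  classical
  have hroot : ∀ n : ℕ, P {ω | outDegree (T ω) [] = n} = ν {n} := by
    intro n
    have := h n fun _ => Set.univ
    simpa using this
  have hcond : ∀ (n : ℕ), P {ω | outDegree (T ω) [] = n} ≠ 0 → ∀ B : Fin n → Set (Set Vertex),
      P[|{ω | outDegree (T ω) [] = n}] {ω | ∀ i : Fin n, shift [Nat.succPNat i] (T ω) ∈ B i} =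
        ∏ i, P {ω | T ω ∈ B i} := by
    intro n h0 B
    rw [cond_apply (measurableSet_outDegree hT ht n)]
    have h3 : {ω | outDegree (T ω) [] = n} ∩
        {ω | ∀ i : Fin n, shift [Nat.succPNat i] (T ω) ∈ B i} =
        {ω | outDegree (T ω) [] = n ∧ ∀ i : Fin n, shift [Nat.succPNat i] (T ω) ∈ B i} := rfl
    rw [h3, h, hroot, ← mul_assoc, ENNReal.inv_mul_cancel, one_mul]
    · rwa [← hroot]
    · rw [← hroot]
      exact measure_ne_top _ _
  have hone : ∀ (n : ℕ), P {ω | outDegree (T ω) [] = n} ≠ 0 → ∀ (i : Fin n)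
      (B : Set (Set Vertex)), P[|{ω | outDegree (T ω) [] = n}]
        {ω | shift [Nat.succPNat i] (T ω) ∈ B} = P {ω | T ω ∈ B} := by
    intro n h0 i B
    -- Constraining one child and leaving the others free gives the marginal laws.
    have := hcond n h0 fun j => if j = i then B else Set.univ
    rw [Finset.prod_eq_single i] at this
    · simp only [if_true] at this
      rw [← this]
      congr 1
      ext ω
      simp only [Set.mem_ofPred_eq]
      constructor
      · intro hω j
        split_ifs with hj
        · rw [hj]; exact hω
        · trivial
      · intro hω
        simpa using hω i
    · intro j _ hj
      simp [hj]
    · simp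
  refine ⟨hT, ht, hroot, fun n h0 => ?_, fun n h0 i => ?_⟩
  · rw [iIndepFun_iff_measure_inter_preimage_eq_mul]
    intro S B _
    have := hcond n h0 fun i => if i ∈ S then B i else Set.univ
    have h1 : {ω | ∀ i : Fin n, shift [Nat.succPNat i] (T ω) ∈
        if i ∈ S then B i else Set.univ} =
        ⋂ i ∈ S, (fun ω => shift [Nat.succPNat i] (T ω)) ⁻¹' B i := by
      ext ω
      simp only [Set.mem_ofPred_eq, Set.mem_iInter, Set.mem_preimage]
      refine forall_congr' fun i => ?_
      split_ifs with hi <;> simp [hi]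
    rw [← h1, this]
    rw [← Finset.prod_subset (Finset.subset_univ S)]
    · refine Finset.prod_congr rfl fun i hi => ?_
      simp only [hi, if_true]
      exact (hone n h0 i (B i)).symm
    · intro i _ hi
      simp [hi]
  · refine ⟨(measurable_shift hT _).aemeasurable, hT.aemeasurable, ?_⟩
    ext B hB
    rw [Measure.map_apply (measurable_shift hT _) hB, Measure.map_apply hT hB]
    exact hone n h0 i B

end Image

/-! ### The marked walk -/

lemma walk_succ {Ω : Type*} (X : ℕ → Ω → ℕ) (s : ℕ) (ω : Ω) :
    walk X (s + 1) ω = walk X s ω + ((X s ω : ℤ) - 1) := Finset.sum_range_succ _ _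

@[simp] lemma walk_zero {Ω : Type*} (X : ℕ → Ω → ℕ) (ω : Ω) : walk X 0 ω = 0 := by simp [walk]

lemma walk_congr {Ω : Type*} {X : ℕ → Ω → ℕ} {s : ℕ} {ω ω' : Ω}
    (h : ∀ i < s, X i ω = X i ω') : walk X s ω = walk X s ω' :=
  Finset.sum_congr rfl fun i hi => by rw [h i (Finset.mem_range.1 hi)]

section Walk

variable {Ω : Type*} {X : ℕ → Ω → ℕ} {Z : ℕ → Ω → Bool}

/-- The walk is nonnegative and meets no mark before time `s`. -/
def unmarkedUpTo (X : ℕ → Ω → ℕ) (Z : ℕ → Ω → Bool) (s : ℕ) : Set Ω :=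
  {ω | ∀ i < s, Z i ω = false ∧ 0 ≤ walk X i ω}

/-- The event that the walk is nonnegative and meets no mark before time `s`, and then is at
`h - 1`. -/
def unmarkedAt (X : ℕ → Ω → ℕ) (Z : ℕ → Ω → Bool) (s h : ℕ) : Set Ω :=
  {ω | ω ∈ unmarkedUpTo X Z s ∧ walk X s ω + 1 = h}

/-- The event that the walk is nonnegative up to time `s` and meets no mark before it, that the next
mark is `b` and that the next position is `h - 1`. -/
def nextAt (X : ℕ → Ω → ℕ) (Z : ℕ → Ω → Bool) (b : Bool) (s h : ℕ) : Set Ω :=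
  {ω | ω ∈ unmarkedUpTo X Z s ∧ 0 ≤ walk X s ω ∧ Z s ω = b ∧ walk X (s + 1) ω + 1 = h}

lemma nextAt_false (s h : ℕ) : nextAt X Z false s h = unmarkedAt X Z (s + 1) h := by
  ext ω
  simp only [nextAt, unmarkedAt, unmarkedUpTo, Set.mem_ofPred_eq, Nat.forall_lt_succ_right]
  tauto

/-- This mirrors `walkStep`: size `h` comes from size `h - k + 1` by a step with `k` children. As `k
≤ h`, the subtraction is exact and the previous position `h - k` is nonnegative, which is the
condition `0 ≤ walk X s ω`. -/
lemma nextAt_eq (b : Bool) (s h : ℕ) : nextAt X Z b s h = ⋃ k ∈ Finset.range (h + 1),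
    unmarkedAt X Z s (h - k + 1) ∩ {ω | X s ω = k ∧ Z s ω = b} := by
  ext ω
  simp only [nextAt, unmarkedAt, walk_succ, Set.mem_ofPred_eq, Set.mem_iUnion, Set.mem_inter_iff,
    Finset.mem_range]
  constructor
  · rintro ⟨h1, h2, h3, h4⟩
    refine ⟨X s ω, by omega, ⟨h1, by omega⟩, rfl, h3⟩
  · rintro ⟨k, hk, ⟨h1, h2⟩, h3, h4⟩
    exact ⟨h1, by omega, h4, by omega⟩

lemma markTime_le_iff (Z : ℕ → Ω → Bool) (ω : Ω) (k : ℕ) :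
    markTime Z ω ≤ k ↔ ∃ j < k, Z j ω = true := by
  constructor
  · intro h
    by_contra! hno
    have : ((k + 1 : ℕ) : ℕ∞) ≤ markTime Z ω := by
      refine le_iInf₂ fun j hj => ?_
      have : k ≤ j := by
        by_contra hlt
        exact hno j (by omega) hj
      exact_mod_cast Nat.succ_le_succ this
    have := this.trans h
    rw [Nat.cast_le] at this
    omega
  · rintro ⟨j, hj, hZ⟩
    exact (iInf₂_le j hZ).trans (by exact_mod_cast hj)

lemma markTime_eq_iff (Z : ℕ → Ω → Bool) (ω : Ω) (s : ℕ) :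
    markTime Z ω = (s + 1 : ℕ) ↔ Z s ω = true ∧ ∀ i < s, Z i ω = false := by
  have h1 := markTime_le_iff Z ω (s + 1)
  have h2 := markTime_le_iff Z ω s
  constructor
  · intro h
    have h3 := h1.1 h.le
    have h4 : ¬ markTime Z ω ≤ s := by
      rw [h, Nat.cast_le]
      omega
    rw [h2] at h4
    push Not at h4
    obtain ⟨j, hj, hZ⟩ := h3
    have hjs : j = s := by
      by_contra hne
      exact h4 j (by omega) hZ
    exact ⟨hjs ▸ hZ, fun i hi => by simpa using h4 i hi⟩
  · rintro ⟨hs, hi⟩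
    refine le_antisymm (h1.2 ⟨s, by omega, hs⟩) ?_
    refine le_iInf₂ fun j hj => ?_
    have : s ≤ j := by
      by_contra hlt
      rw [hi j (by omega)] at hj
      exact absurd hj (by simp)
    exact_mod_cast Nat.succ_le_succ this

lemma markTime_le_hitTime_iff (X : ℕ → Ω → ℕ) (Z : ℕ → Ω → Bool) (ω : Ω) :
    markTime Z ω ≤ hitTime X ω ↔ ∀ k, 1 ≤ k → walk X k ω = -1 → ∃ j < k, Z j ω = true := by
  simp only [hitTime, le_iInf_iff, and_imp, markTime_le_iff]

/-- Steps are at least -1, so the walk cannot become negative without visiting -1. -/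
lemma walk_nonneg_of_ne {s : ℕ} {ω : Ω} (h : ∀ k, 1 ≤ k → k ≤ s → walk X k ω ≠ -1) :
    0 ≤ walk X s ω := by
  induction s with
  | zero => simp
  | succ s ih =>
    have h1 := ih fun k hk hks => h k hk (by omega)
    have h2 := h (s + 1) (by omega) le_rfl
    have := walk_succ X s ω
    omega

/-- The first marked step is the step `s + 1` and comes no later than the hitting time of `-1`. -/
lemma mem_nextAt_true_iff (s n : ℕ) (ω : Ω) : ω ∈ nextAt X Z true s n ↔
    markTime Z ω = (s + 1 : ℕ) ∧ markTime Z ω ≤ hitTime X ω ∧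
      1 + walk X (markTime Z ω).toNat ω = n := by
  rw [markTime_le_hitTime_iff]
  simp only [nextAt, unmarkedUpTo, Set.mem_ofPred_eq]
  constructor
  · rintro ⟨h1, h2, h3, h4⟩
    have h5 : markTime Z ω = (s + 1 : ℕ) := (markTime_eq_iff Z ω s).2 ⟨h3, fun i hi => (h1 i hi).1⟩
    refine ⟨h5, fun k hk hw => ?_, ?_⟩
    · refine ⟨s, ?_, h3⟩
      by_contra hks
      rcases Nat.lt_or_ge k s with hlt | hge
      · have := (h1 k hlt).2
        omega
      · obtain rfl : k = s := by omega
        omega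
    · rw [h5, ENat.toNat_natCast]
      omega
  · rintro ⟨h5, h6, h7⟩
    obtain ⟨h3, h8⟩ := (markTime_eq_iff Z ω s).1 h5
    have h9 : ∀ k, k ≤ s → 0 ≤ walk X k ω := fun k hk => by
      refine walk_nonneg_of_ne fun l hl hlk hw => ?_
      obtain ⟨j, hj, hZ⟩ := h6 l hl hw
      rw [h8 j (by omega)] at hZ
      exact absurd hZ (by simp)
    rw [h5, ENat.toNat_natCast] at h7
    exact ⟨fun i hi => ⟨h8 i hi, h9 i hi.le⟩, h9 s le_rfl, h3, by omega⟩

lemma unmarkedAt_congr (s h : ℕ) (ω ω' : Ω)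
    (hω : ∀ i < s, X i ω = X i ω' ∧ Z i ω = Z i ω') (hmem : ω ∈ unmarkedAt X Z s h) :
    ω' ∈ unmarkedAt X Z s h := by
  refine ⟨fun i hi => ?_, ?_⟩
  · rw [← (hω i hi).2, ← walk_congr fun j hj => (hω j (hj.trans hi)).1]
    exact hmem.1 i hi
  · rw [← walk_congr fun j hj => (hω j hj).1]
    exact hmem.2

variable [MeasurableSpace Ω] {P : Measure Ω} {p : Measure ℕ} {q : ℕ → I}

lemma IsMarkedWalk.measure_step [IsProbabilityMeasure P] (h : IsMarkedWalk P X Z p q) (i k : ℕ)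
    (b : Bool) : P {ω | X i ω = k ∧ Z i ω = b} = markedWeight p q b k := by
  have hX : MeasurableSet {ω | X i ω = k} := h.measurable_steps i (measurableSet_singleton k)
  have hZ : MeasurableSet {ω | Z i ω = true} := h.measurable_marks i (measurableSet_singleton true)
  cases b with
  | true => simpa [markedWeight, markProb] using h.mark_law i k
  | false =>
    have h1 : {ω | X i ω = k ∧ Z i ω = false} =
        {ω | X i ω = k} \ {ω | X i ω = k ∧ Z i ω = true} := by
      ext ω
      simp only [Set.mem_ofPred_eq, Set.mem_sdiff, not_and, Bool.not_eq_true]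
      tauto
    have h2 : p {k} ≠ ∞ := by
      rw [← h.step_law i k]
      exact measure_ne_top _ _
    rw [h1, measure_sdiff
      (show {ω | X i ω = k ∧ Z i ω = true} ⊆ {ω | X i ω = k} from fun ω hω => hω.1)
      (show MeasurableSet {ω | X i ω = k ∧ Z i ω = true} from hX.inter hZ).nullMeasurableSet
      (measure_ne_top _ _),
      h.step_law, h.mark_law]
    simp only [markedWeight, markProb, Bool.false_eq_true, if_false]
    rw [ENNReal.mul_sub fun _ _ => h2, mul_one]

/-- Independence of a step from the events of the past. -/
lemma IsMarkedWalk.measure_inter_step [IsProbabilityMeasure P] (h : IsMarkedWalk P X Z p q) (s : ℕ)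
    {E : Set Ω} (hE : ∀ ω ω', (∀ i < s, X i ω = X i ω' ∧ Z i ω = Z i ω') → ω ∈ E → ω' ∈ E)
    (D : Set (ℕ × Bool)) :
    P (E ∩ {ω | (X s ω, Z s ω) ∈ D}) = P E * P {ω | (X s ω, Z s ω) ∈ D} := by
  have hind := h.indep.indepFun_finset (Finset.range s) {s} (by simp)
    fun i => (h.measurable_steps i).prodMk (h.measurable_marks i)
  set F : Ω → (Finset.range s → ℕ × Bool) := fun ω i => (X i ω, Z i ω) with hF
  -- `E` depends on the past only through `F`, whose values lie in a countable discrete space, so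
  -- that every set of values is measurable.
  have hEF : E = F ⁻¹' (F '' E) := by
    refine Set.Subset.antisymm (Set.subset_preimage_image F E) ?_
    rintro ω' ⟨ω, hω, heq⟩
    refine hE ω ω' (fun i hi => ?_) hω
    have := congrFun heq ⟨i, Finset.mem_range.2 hi⟩
    simpa [hF] using this
  have hDF : {ω | (X s ω, Z s ω) ∈ D} =
      (fun ω (i : ({s} : Finset ℕ)) => (X i ω, Z i ω)) ⁻¹' {y | y ⟨s, by simp⟩ ∈ D} := rfl
  rw [hDF, hEF]
  exact hind.measure_inter_preimage_eq_mul _ _ (Set.to_countable _).measurableSet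
    (Set.to_countable _).measurableSet

lemma measurable_walk (hX : ∀ i, Measurable (X i)) (s : ℕ) : Measurable (walk X s) := by
  unfold walk
  exact Finset.measurable_fun_sum _ fun i _ =>
    (measurable_from_nat (f := fun n : ℕ => (n : ℤ) - 1)).comp (hX i)

lemma IsMarkedWalk.measurableSet_unmarkedAt (h : IsMarkedWalk P X Z p q) (s n : ℕ) :
    MeasurableSet (unmarkedAt X Z s n) := by
  have h1 : unmarkedAt X Z s n = (⋂ i : ℕ, ⋂ _ : i < s, {ω | Z i ω = false} ∩
      walk X i ⁻¹' Set.Ici 0) ∩ walk X s ⁻¹' {(n : ℤ) - 1} := by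
    ext ω
    simp only [unmarkedAt, unmarkedUpTo, Set.mem_ofPred_eq, Set.mem_inter_iff, Set.mem_iInter,
      Set.mem_preimage, Set.mem_Ici, Set.mem_singleton_iff, eq_sub_iff_add_eq]
  rw [h1]
  refine (MeasurableSet.iInter fun i => MeasurableSet.iInter fun _ => ?_).inter
    (measurable_walk h.measurable_steps s (measurableSet_singleton _))
  exact (h.measurable_marks i (measurableSet_singleton false)).inter
    (measurable_walk h.measurable_steps i measurableSet_Ici)

lemma IsMarkedWalk.measurableSet_step (h : IsMarkedWalk P X Z p q) (s k : ℕ) (b : Bool) :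
    MeasurableSet {ω | X s ω = k ∧ Z s ω = b} :=
  (h.measurable_steps s (measurableSet_singleton k)).inter
    (h.measurable_marks s (measurableSet_singleton b))

lemma IsMarkedWalk.measurableSet_nextAt (h : IsMarkedWalk P X Z p q) (b : Bool) (s n : ℕ) :
    MeasurableSet (nextAt X Z b s n) := by
  rw [nextAt_eq]
  exact Finset.measurableSet_biUnion _ fun k _ =>
    (h.measurableSet_unmarkedAt s _).inter (h.measurableSet_step s k b)

lemma IsMarkedWalk.measure_nextAt_of [IsProbabilityMeasure P] (h : IsMarkedWalk P X Z p q)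
    (b : Bool) (s n : ℕ) {v : ℕ → ℝ≥0∞} (hv : ∀ j, P (unmarkedAt X Z s j) = v j) :
    P (nextAt X Z b s n) = walkStep (markedWeight p q b) v n := by
  rw [nextAt_eq, measure_biUnion_finset, walkStep]
  · refine Finset.sum_congr rfl fun k _ => ?_
    have h1 := h.measure_inter_step s (unmarkedAt_congr s (n - k + 1)) {(k, b)}
    simp only [Set.mem_singleton_iff, Prod.mk.injEq] at h1
    rw [h1, hv, h.measure_step, mul_comm]
  · intro k _ l _ hkl
    rw [Function.onFun, Set.disjoint_left]
    rintro ω ⟨_, h1, _⟩ ⟨_, h2, _⟩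
    exact hkl (h1.symm.trans h2)
  · exact fun k _ => (h.measurableSet_unmarkedAt s _).inter (h.measurableSet_step s k b)

lemma IsMarkedWalk.measure_unmarkedAt [IsProbabilityMeasure P] (h : IsMarkedWalk P X Z p q)
    (s n : ℕ) : P (unmarkedAt X Z s n) = sizeLaw (markedWeight p q false) s n := by
  induction s generalizing n with
  | zero =>
    by_cases hn : n = 1
    · have : unmarkedAt X Z 0 n = Set.univ := by
        ext ω
        simp [unmarkedAt, unmarkedUpTo, hn]
      simp only [this, sizeLaw, if_pos hn, measure_univ]
    · have : unmarkedAt X Z 0 n = ∅ := by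
        ext ω
        simp only [unmarkedAt, unmarkedUpTo, Set.mem_ofPred_eq, walk_zero,
          Set.mem_empty_iff_false, iff_false]
        rintro ⟨-, h2⟩
        omega
      simp [this, sizeLaw, hn]
  | succ s ih =>
    rw [← nextAt_false, h.measure_nextAt_of false s n ih]
    rfl

/-- The probability that a step is not marked. -/
noncomputable def unmarkedProb (p : Measure ℕ) (q : ℕ → I) : ℝ≥0∞ :=
  ∑' n, markedWeight p q false n

lemma unmarkedProb_lt_one [IsProbabilityMeasure p] (hpq : ∃ k : ℕ, 0 < p {k} ∧ 0 < (q k : ℝ)) :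
    unmarkedProb p q < 1 := by
  obtain ⟨k, hk, hq⟩ := hpq
  have h1 : ∑' n, markedWeight p q true n + unmarkedProb p q = 1 := by
    rw [unmarkedProb, ← ENNReal.tsum_add, ← sum_singleton p]
    exact tsum_congr fun n => markedWeight_add p q n
  have h2 : 0 < ∑' n, markedWeight p q true n := by
    refine lt_of_lt_of_le ?_ (ENNReal.le_tsum k)
    rw [markedWeight, markProb, if_pos rfl]
    exact ENNReal.mul_pos hk.ne' (ENNReal.ofReal_pos.2 hq).ne'
  have h3 : unmarkedProb p q ≠ ∞ := by
    intro h
    rw [h, add_top] at h1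
    exact ENNReal.top_ne_one h1
  calc unmarkedProb p q < ∑' n, markedWeight p q true n + unmarkedProb p q := by
        rw [add_comm]
        exact ENNReal.lt_add_right h3 h2.ne'
    _ = 1 := h1

lemma IsMarkedWalk.measure_no_mark [IsProbabilityMeasure P] (h : IsMarkedWalk P X Z p q) (s : ℕ) :
    P {ω | ∀ i < s, Z i ω = false} = unmarkedProb p q ^ s := by
  induction s with
  | zero => simp
  | succ s ih =>
    have h1 := h.measure_inter_step s (E := {ω | ∀ i < s, Z i ω = false})
      (fun ω ω' hω hE i hi => by rw [← (hω i hi).2]; exact hE i hi) {y | y.2 = false}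
    have h2 : {ω | (X s ω, Z s ω) ∈ {y : ℕ × Bool | y.2 = false}} =
        ⋃ k, {ω | X s ω = k ∧ Z s ω = false} := by
      ext ω
      simp
    have h3 : {ω | ∀ i < s + 1, Z i ω = false} = {ω | ∀ i < s, Z i ω = false} ∩
        {ω | (X s ω, Z s ω) ∈ {y : ℕ × Bool | y.2 = false}} := by
      ext ω
      simp only [Set.mem_ofPred_eq, Set.mem_inter_iff, Nat.forall_lt_succ_right]
    rw [h3, h1, ih, h2, measure_iUnion, pow_succ, unmarkedProb]
    · congr 1
      exact tsum_congr fun k => h.measure_step s k false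
    · intro k l hkl
      rw [Function.onFun, Set.disjoint_left]
      rintro ω ⟨h1, _⟩ ⟨h2, _⟩
      exact hkl (h1.symm.trans h2)
    · exact fun k => h.measurableSet_step s k false

lemma IsMarkedWalk.measure_never_marked [IsProbabilityMeasure P] (h : IsMarkedWalk P X Z p q)
    (hc : unmarkedProb p q < 1) : P {ω | ∀ i, Z i ω = false} = 0 := by
  refine le_antisymm ?_ zero_le
  refine ge_of_tendsto' (ENNReal.tendsto_pow_atTop_nhds_zero_of_lt_one hc) fun s => ?_
  rw [← h.measure_no_mark s]
  exact measure_mono fun ω hω i _ => hω i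

lemma IsMarkedWalk.measurableSet_markTime_le (h : IsMarkedWalk P X Z p q) :
    MeasurableSet {ω | markTime Z ω ≤ hitTime X ω} := by
  have : {ω | markTime Z ω ≤ hitTime X ω} = ⋂ k : ℕ, ⋂ _ : 1 ≤ k, (walk X k ⁻¹' {-1})ᶜ ∪
      ⋃ j : ℕ, ⋃ _ : j < k, {ω | Z j ω = true} := by
    ext ω
    simp only [Set.mem_ofPred_eq, markTime_le_hitTime_iff, Set.mem_iInter, Set.mem_union,
      Set.mem_compl_iff, Set.mem_preimage, Set.mem_singleton_iff, Set.mem_iUnion, exists_prop,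
      imp_iff_not_or]
  rw [this]
  refine MeasurableSet.iInter fun k => MeasurableSet.iInter fun _ => ?_
  refine (measurable_walk h.measurable_steps k (measurableSet_singleton _)).compl.union ?_
  exact MeasurableSet.iUnion fun j => MeasurableSet.iUnion fun _ =>
    h.measurable_marks j (measurableSet_singleton true)

/-- The law of the position of the walk at the first mark. -/
lemma IsMarkedWalk.measure_hit [IsProbabilityMeasure P] (h : IsMarkedWalk P X Z p q)
    (hc : unmarkedProb p q < 1) (n : ℕ) :
    P ({ω | markTime Z ω ≤ hitTime X ω} ∩ {ω | 1 + walk X (markTime Z ω).toNat ω = n}) =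
      hitLaw (markedWeight p q) n := by
  -- Without any mark, `markTime` is `⊤` and its `toNat` is 0, a spurious value; this null event is
  -- removed before splitting by the time of the first mark.
  have hsplit : {ω | markTime Z ω ≤ hitTime X ω} ∩ {ω | 1 + walk X (markTime Z ω).toNat ω = n} ∩
      {ω | ∀ i, Z i ω = false}ᶜ = ⋃ s, nextAt X Z true s n := by
    ext ω
    simp only [Set.mem_inter_iff, Set.mem_ofPred_eq, Set.mem_compl_iff, Set.mem_iUnion,
      mem_nextAt_true_iff]
    constructor
    · rintro ⟨⟨h1, h2⟩, h3⟩
      have h4 : ∃ i, Z i ω = true := by simpa using h3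
      classical
      refine ⟨Nat.find h4, (markTime_eq_iff Z ω _).2 ⟨Nat.find_spec h4, fun i hi => ?_⟩, h1, h2⟩
      simpa using Nat.find_min h4 hi
    · rintro ⟨s, h1, h2, h3⟩
      refine ⟨⟨h2, h3⟩, fun h4 => ?_⟩
      have := ((markTime_eq_iff Z ω s).1 h1).1
      rw [h4 s] at this
      exact absurd this (by simp)
  rw [← measure_inter_conull (t := {ω | ∀ i, Z i ω = false}ᶜ)
    (by rw [compl_compl]; exact h.measure_never_marked hc), hsplit, measure_iUnion, hitLaw]
  · exact tsum_congr fun s => h.measure_nextAt_of true s n fun j => h.measure_unmarkedAt s j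
  · intro s t hst
    rw [Function.onFun, Set.disjoint_left]
    intro ω h1 h2
    rw [mem_nextAt_true_iff] at h1 h2
    have := h1.1.symm.trans h2.1
    rw [Nat.cast_inj] at this
    omega
  · exact fun s => h.measurableSet_nextAt true s n

end Walk

/-! ### The mean size of the forest after the first mark -/

lemma tsum_antidiagonal (F : ℕ → ℕ → ℝ≥0∞) :
    ∑' h, ∑ k ∈ Finset.range (h + 1), F k (h - k) = ∑' j, ∑' k, F k j := by
  have hprod : ∑' x : ℕ × ℕ, F x.1 x.2 = ∑' k, ∑' j, F k j := ENNReal.tsum_prod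
  rw [ENNReal.tsum_comm, ← hprod,
    ← Finset.HasAntidiagonal.sigmaAntidiagonalEquivProd.tsum_eq fun x : ℕ × ℕ => F x.1 x.2,
    ENNReal.tsum_sigma']
  refine tsum_congr fun h => ?_
  rw [tsum_fintype, ← Finset.Nat.sum_antidiagonal_eq_sum_range_succ F h,
    ← Finset.sum_coe_sort]
  rfl

/-- Setting `h = j + k` decouples the sums: from `j + 1` trees, a step with `k` children leads to `j
+ k` trees. -/
lemma tsum_mul_walkStep (g r v : ℕ → ℝ≥0∞) :
    ∑' h, g h * walkStep r v h = ∑' j, v (j + 1) * ∑' k, g (j + k) * r k := by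
  have h1 : ∀ h, g h * walkStep r v h = ∑ k ∈ Finset.range (h + 1),
      (fun k j => v (j + 1) * (g (j + k) * r k)) k (h - k) := by
    intro h
    rw [walkStep, Finset.mul_sum]
    refine Finset.sum_congr rfl fun k hk => ?_
    have : h - k + k = h := Nat.sub_add_cancel (Nat.lt_succ_iff.1 (Finset.mem_range.1 hk))
    simp only [this]
    ring
  rw [tsum_congr h1, tsum_antidiagonal fun k j => v (j + 1) * (g (j + k) * r k)]
  simp_rw [ENNReal.tsum_mul_left]

lemma tsum_succ_le (v : ℕ → ℝ≥0∞) : ∑' j, v (j + 1) ≤ ∑' j, v j :=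
  ENNReal.tsum_comp_le_tsum_of_injective (Nat.succ_injective) v

section

variable {w : Bool → ℕ → ℝ≥0∞}

lemma tsum_sizeLaw_le (r : ℕ → ℝ≥0∞) (s : ℕ) : ∑' h, sizeLaw r s h ≤ (∑' k, r k) ^ s := by
  induction s with
  | zero => simp [sizeLaw]
  | succ s ih =>
    have h1 := tsum_mul_walkStep (fun _ => 1) r (sizeLaw r s)
    simp only [one_mul] at h1
    rw [sizeLaw, h1, ENNReal.tsum_mul_right, pow_succ]
    gcongr
    exact (tsum_succ_le _).trans ih

/-- With `c = ∑ r k`, an unmarked step from size `j + 1` contributes `j c + ∑ k r k ≤ (j + 1) c +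
1`. Hence the mean sizes satisfy M (s + 1) ≤ c M s + c ^ s with M 0 = 1. -/
lemma tsum_mul_sizeLaw_le {r : ℕ → ℝ≥0∞} (hr : ∑' k : ℕ, (k : ℝ≥0∞) * r k ≤ 1) (s : ℕ) :
    ∑' h : ℕ, (h : ℝ≥0∞) * sizeLaw r (s + 1) h ≤
      (∑' k, r k) ^ (s + 1) + (s + 1 : ℕ) * (∑' k, r k) ^ s := by
  set c := ∑' k, r k with hc
  have hstep : ∀ s, ∑' h : ℕ, (h : ℝ≥0∞) * sizeLaw r (s + 1) h ≤
      c * ∑' h : ℕ, (h : ℝ≥0∞) * sizeLaw r s h + c ^ s := by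
    intro s
    have h1 : ∀ j : ℕ, sizeLaw r s (j + 1) * ∑' k : ℕ, ((j + k : ℕ) : ℝ≥0∞) * r k ≤
        c * (((j + 1 : ℕ) : ℝ≥0∞) * sizeLaw r s (j + 1)) + sizeLaw r s (j + 1) := by
      intro j
      have h2 : ∑' k : ℕ, ((j + k : ℕ) : ℝ≥0∞) * r k ≤ ((j + 1 : ℕ) : ℝ≥0∞) * c + 1 := by
        push_cast
        simp_rw [add_mul]
        rw [ENNReal.tsum_add, ENNReal.tsum_mul_left, ← hc]
        exact add_le_add (le_add_right le_rfl) hr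
      calc _ ≤ sizeLaw r s (j + 1) * (((j + 1 : ℕ) : ℝ≥0∞) * c + 1) := by gcongr
        _ = _ := by ring
    rw [sizeLaw, tsum_mul_walkStep (fun h => (h : ℝ≥0∞))]
    refine (ENNReal.tsum_le_tsum h1).trans ?_
    rw [ENNReal.tsum_add, ENNReal.tsum_mul_left]
    exact add_le_add (mul_le_mul' le_rfl (tsum_succ_le fun h : ℕ => (h : ℝ≥0∞) * sizeLaw r s h))
      ((tsum_succ_le _).trans (tsum_sizeLaw_le r s))
  induction s with
  | zero =>
    refine (hstep 0).trans (le_of_eq ?_)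
    have : ∑' h : ℕ, (h : ℝ≥0∞) * sizeLaw r 0 h = 1 := by
      rw [tsum_eq_single 1]
      · simp [sizeLaw]
      · intro h hh
        simp [sizeLaw, hh]
    rw [this]
    simp
  | succ s ih =>
    refine (hstep (s + 1)).trans ?_
    calc _ ≤ c * (c ^ (s + 1) + (s + 1 : ℕ) * c ^ s) + c ^ (s + 1) := by gcongr
      _ = _ := by push_cast; ring

lemma tendsto_tsum_mul_sizeLaw {r : ℕ → ℝ≥0∞} (hr : ∑' k : ℕ, (k : ℝ≥0∞) * r k ≤ 1)
    (hc : ∑' k, r k < 1) :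
    Filter.Tendsto (fun s => ∑' h : ℕ, (h : ℝ≥0∞) * sizeLaw r s h) Filter.atTop (nhds 0) := by
  rw [← Filter.tendsto_add_atTop_iff_nat 1]
  set c := ∑' k, r k with hcdef
  have h1 : ∀ s : ℕ, c ^ (s + 1) + (s + 1 : ℕ) * c ^ s =
      ENNReal.ofReal (c.toReal ^ (s + 1) + (s * c.toReal ^ s + c.toReal ^ s)) := by
    intro s
    have h0 : 0 ≤ c.toReal := ENNReal.toReal_nonneg
    have hct : c ≠ ∞ := (hc.trans ENNReal.one_lt_top).ne
    rw [ENNReal.ofReal_add (by positivity) (by positivity),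
      ENNReal.ofReal_add (by positivity) (by positivity), ENNReal.ofReal_mul (by positivity)]
    simp only [ENNReal.ofReal_pow h0, ENNReal.ofReal_toReal hct, ENNReal.ofReal_natCast]
    push_cast
    ring
  have hx0 : 0 ≤ c.toReal := ENNReal.toReal_nonneg
  have hx1 : c.toReal < 1 := by
    rw [← ENNReal.toReal_one]
    exact ENNReal.toReal_strict_mono ENNReal.one_ne_top hc
  have h2 := tendsto_pow_atTop_nhds_zero_of_lt_one hx0 hx1
  have h3 := tendsto_self_mul_const_pow_of_lt_one hx0 hx1
  have h4 := ((Filter.tendsto_add_atTop_iff_nat 1).2 h2).add (h3.add h2)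
  have h5 := ENNReal.tendsto_ofReal h4
  simp only [add_zero, ENNReal.ofReal_zero] at h5
  refine tendsto_of_tendsto_of_tendsto_of_le_of_le tendsto_const_nhds h5 (fun s => zero_le)
    fun s => ?_
  rw [← h1]
  exact tsum_mul_sizeLaw_le hr s

/-- Criticality makes the mean size after a step from `j + 1` equal to `j + 1`, shared between
unmarked and marked outcomes. No step starts from size 0, but that size does not contribute to the
mean. -/
lemma tsum_mul_sizeLaw_eq (h0 : ∑' k, (w true k + w false k) = 1)
    (h1 : ∑' k : ℕ, (k : ℝ≥0∞) * (w true k + w false k) = 1) (s : ℕ) :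
    ∑' h : ℕ, (h : ℝ≥0∞) * sizeLaw (w false) s h =
      ∑' h : ℕ, (h : ℝ≥0∞) * sizeLaw (w false) (s + 1) h +
      ∑' h : ℕ, (h : ℝ≥0∞) * walkStep (w true) (sizeLaw (w false) s) h := by
  rw [sizeLaw, tsum_mul_walkStep (fun h => (h : ℝ≥0∞)), tsum_mul_walkStep (fun h => (h : ℝ≥0∞)),
    ← ENNReal.tsum_add, tsum_eq_zero_add' ENNReal.summable, Nat.cast_zero, zero_mul, zero_add]
  refine tsum_congr fun j => ?_
  rw [← mul_add, ← ENNReal.tsum_add]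
  have : ∑' k : ℕ, (((j + k : ℕ) : ℝ≥0∞) * w false k + ((j + k : ℕ) : ℝ≥0∞) * w true k) =
      ((j + 1 : ℕ) : ℝ≥0∞) := by
    calc _ = ∑' k : ℕ, ((j : ℝ≥0∞) * (w true k + w false k) +
          (k : ℝ≥0∞) * (w true k + w false k)) := by
          refine tsum_congr fun k => ?_
          push_cast
          ring
      _ = _ := by
          rw [ENNReal.tsum_add, ENNReal.tsum_mul_left, h0, h1]
          push_cast
          ring
  rw [this, mul_comm]

/-- Optional stopping: the mean size still running plus the mean size already stopped is 1 at every
time, and the running part tends to 0. -/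
lemma tsum_mul_hitLaw (h0 : ∑' k, (w true k + w false k) = 1)
    (h1 : ∑' k : ℕ, (k : ℝ≥0∞) * (w true k + w false k) = 1) (hc : ∑' k, w false k < 1) :
    ∑' n : ℕ, (n : ℝ≥0∞) * hitLaw w n = 1 := by
  have hr : ∑' k : ℕ, (k : ℝ≥0∞) * w false k ≤ 1 := by
    rw [← h1]
    exact ENNReal.tsum_le_tsum fun k => by gcongr; exact le_add_self
  set m : ℕ → ℝ≥0∞ := fun s => ∑' h : ℕ, (h : ℝ≥0∞) * sizeLaw (w false) s h with hm
  set a : ℕ → ℝ≥0∞ := fun s =>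
    ∑' h : ℕ, (h : ℝ≥0∞) * walkStep (w true) (sizeLaw (w false) s) h with ha
  have hm0 : m 0 = 1 := by
    simp only [hm]
    rw [tsum_eq_single 1]
    · simp [sizeLaw]
    · intro h hh
      simp [sizeLaw, hh]
  have hsum : ∀ s, m s + ∑ i ∈ Finset.range s, a i = 1 := by
    intro s
    induction s with
    | zero => simp [hm0]
    | succ s ih =>
      rw [Finset.sum_range_succ, ← ih]
      have : m s = m (s + 1) + a s := tsum_mul_sizeLaw_eq h0 h1 s
      rw [this]
      ring
  have hlim := (tendsto_tsum_mul_sizeLaw hr hc).add (ENNReal.tendsto_nat_tsum a)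
  have hone := tendsto_nhds_unique (hlim.congr fun s => hsum s) tendsto_const_nhds
  rw [zero_add] at hone
  simp only [hitLaw, ← ENNReal.tsum_mul_left]
  rw [ENNReal.tsum_comm]
  exact hone

lemma le_walkStep (r v : ℕ → ℝ≥0∞) (j k : ℕ) : r k * v (j + 1) ≤ walkStep r v (j + k) := by
  have := Finset.single_le_sum (f := fun k' => r k' * v (j + k - k' + 1)) (fun _ _ => zero_le)
    (Finset.mem_range.2 (show k < j + k + 1 by omega))
  simpa [walkStep] using this

lemma exists_hitLaw_ne_zero {k₀ k₁ : ℕ} (hk₀ : w true k₀ ≠ 0) (hk₁ : 2 ≤ k₁)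
    (hw : w true k₁ + w false k₁ ≠ 0) : ∃ n, 2 ≤ n ∧ hitLaw w n ≠ 0 := by
  have hle : ∀ s n, walkStep (w true) (sizeLaw (w false) s) n ≤ hitLaw w n := fun s n =>
    ENNReal.le_tsum (f := fun s => walkStep (w true) (sizeLaw (w false) s) n) s
  have hne : ∀ (r v : ℕ → ℝ≥0∞) (j k : ℕ), r k ≠ 0 → v (j + 1) ≠ 0 → walkStep r v (j + k) ≠ 0 :=
    fun r v j k h1 h2 h3 => mul_ne_zero h1 h2 (le_antisymm (h3 ▸ le_walkStep r v j k) zero_le)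
  have hpos : ∀ s n, walkStep (w true) (sizeLaw (w false) s) n ≠ 0 → hitLaw w n ≠ 0 :=
    fun s n h1 h2 => h1 (le_antisymm (h2 ▸ hle s n) zero_le)
  by_cases h : w true k₁ = 0
  · have hf : w false k₁ ≠ 0 := by simpa [h] using hw
    obtain ⟨l, rfl⟩ : ∃ l, k₁ = l + 1 := ⟨k₁ - 1, by omega⟩
    -- Two unmarked steps with `l + 1` children take the size from 1 to `2 l + 1`, and the marked
    -- step leads to `2 l + k₀ ≥ 2`. One unmarked step would not suffice when `l = 1` and `k₀ = 0`.
    refine ⟨(l + l) + k₀, by omega, hpos 2 _ (hne _ _ _ _ hk₀ ?_)⟩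
    refine hne _ _ l (l + 1) hf ?_
    have := hne (w false) (sizeLaw (w false) 0) 0 (l + 1) hf (by simp [sizeLaw])
    rwa [zero_add] at this
  · refine ⟨0 + k₁, by omega, hpos 0 _ (hne _ _ _ _ h (by simp [sizeLaw]))⟩

end

/-! ### Binomial thinning -/

lemma tsum_binomial_mean {γ δ : ℝ≥0∞} (h : γ + δ = 1) (N : ℕ) :
    ∑' k : ℕ, (k : ℝ≥0∞) * ((N.choose k : ℝ≥0∞) * γ ^ k * δ ^ (N - k)) = N * γ := by
  rw [tsum_eq_zero_add' ENNReal.summable, Nat.cast_zero, zero_mul, zero_add]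
  rcases N with _ | N
  · simp
  · have h1 : ∀ k : ℕ, ((k + 1 : ℕ) : ℝ≥0∞) *
        (((N + 1).choose (k + 1) : ℝ≥0∞) * γ ^ (k + 1) * δ ^ (N + 1 - (k + 1))) =
        ((N + 1 : ℕ) : ℝ≥0∞) * γ * (γ ^ k * δ ^ (N - k) * (N.choose k : ℝ≥0∞)) := by
      intro k
      have h2 : ((k + 1 : ℕ) : ℝ≥0∞) * ((N + 1).choose (k + 1) : ℝ≥0∞) =
          ((N + 1 : ℕ) : ℝ≥0∞) * (N.choose k : ℝ≥0∞) := by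
        rw [← Nat.cast_mul, ← Nat.cast_mul, Nat.add_one_mul_choose_eq, mul_comm (k + 1)]
      rw [Nat.add_sub_add_right, ← mul_assoc, ← mul_assoc, h2]
      ring
    simp_rw [h1]
    rw [ENNReal.tsum_mul_left, tsum_eq_sum (s := Finset.range (N + 1)), ← add_pow, h, one_pow,
      mul_one]
    intro k hk
    rw [Nat.choose_eq_zero_of_lt (by simpa using hk)]
    simp

/-- A probability measure on `ℕ` of mean one, other than the point mass at one, satisfies the
standing assumptions on offspring distributions. -/
lemma isOffspringLaw_of_mean_eq_one {ν : Measure ℕ} [IsProbabilityMeasure ν] (hmean : mean ν = 1)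
    {n : ℕ} (hn : 2 ≤ n) (hν : ν {n} ≠ 0) : IsOffspringLaw ν where
  isProbabilityMeasure := inferInstance
  zero_pos := by
    rw [pos_iff_ne_zero]
    intro h0
    -- The truncation of `k - 1` at `k = 0` is harmless because `ν {0} = 0`; mean one then forces
    -- the sum of `(k - 1) * ν {k}` to be 0, against the atom at `n`.
    have h1 : ∀ k : ℕ, (k : ℝ≥0∞) * ν {k} = ν {k} + ((k - 1 : ℕ) : ℝ≥0∞) * ν {k} := by
      intro k
      rcases k with _ | k
      · simp [h0]
      · rw [Nat.add_sub_cancel]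
        push_cast
        ring
    rw [mean_eq_tsum] at hmean
    simp_rw [h1] at hmean
    rw [ENNReal.tsum_add, sum_singleton] at hmean
    have h2 : ∑' k : ℕ, ((k - 1 : ℕ) : ℝ≥0∞) * ν {k} = 0 := by
      have : (1 : ℝ≥0∞) + ∑' k : ℕ, ((k - 1 : ℕ) : ℝ≥0∞) * ν {k} = 1 + 0 := by rw [hmean, add_zero]
      exact (ENNReal.add_right_inj ENNReal.one_ne_top).1 this
    have h3 := ENNReal.tsum_eq_zero.1 h2 n
    rw [mul_eq_zero, Nat.cast_eq_zero] at h3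
    rcases h3 with h3 | h3
    · omega
    · exact hν h3
  zero_add_one_lt := by
    have h1 : ∑ k ∈ ({0, 1, n} : Finset ℕ), ν {k} ≤ 1 := by
      rw [← sum_singleton ν]
      exact ENNReal.sum_le_tsum _
    rw [Finset.sum_insert (by simp; omega), Finset.sum_insert (by simp; omega),
      Finset.sum_singleton, ← add_assoc] at h1
    refine lt_of_lt_of_le (ENNReal.lt_add_right ?_ hν) h1
    exact ENNReal.add_ne_top.2 ⟨measure_ne_top _ _, measure_ne_top _ _⟩
  mean_lt_top := by rw [hmean]; exact ENNReal.one_lt_top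

/-! ### The law of `Y` -/

section Thinning

variable {Ω Ω' : Type*} [MeasurableSpace Ω] [MeasurableSpace Ω'] {P : Measure Ω}
  {P' : Measure Ω'} [IsProbabilityMeasure P] {p : Measure ℕ} {q : ℕ → I}
  {X : ℕ → Ω → ℕ} {Z : ℕ → Ω → Bool} {Xt Y : Ω' → ℕ}

lemma IsMarkedWalk.measure_eq_of_identDistrib (h : IsMarkedWalk P X Z p q)
    (hc : unmarkedProb p q < 1)
    (hXt : IdentDistrib (fun ω => (Xt ω : ℤ))
      (fun ω => 1 + walk X (markTime Z ω).toNat ω) P' (P[|{ω | markTime Z ω ≤ hitTime X ω}]))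
    (n : ℕ) : P' {ω | Xt ω = n} =
      (P {ω | markTime Z ω ≤ hitTime X ω})⁻¹ * hitLaw (markedWeight p q) n := by
  have h1 := hXt.measure_mem_eq (measurableSet_singleton (n : ℤ))
  rw [cond_apply h.measurableSet_markTime_le] at h1
  have h2 := h.measure_hit hc n
  rw [← h2]
  convert h1 using 2
  · ext ω
    simp
  · rfl

/-- The law of `Xt` has mass one and is proportional to `hitLaw`, which determines the normalizing
constant and forces it to be nonzero. -/
lemma IsMarkedWalk.measure_le_hitTime_eq [IsProbabilityMeasure P'] (h : IsMarkedWalk P X Z p q)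
    (hc : unmarkedProb p q < 1)
    (hXm : Measurable Xt) (hXt : IdentDistrib (fun ω => (Xt ω : ℤ))
      (fun ω => 1 + walk X (markTime Z ω).toNat ω) P' (P[|{ω | markTime Z ω ≤ hitTime X ω}])) :
    P {ω | markTime Z ω ≤ hitTime X ω} = ∑' n, hitLaw (markedWeight p q) n := by
  set g := P {ω | markTime Z ω ≤ hitTime X ω} with hg
  have h1 : ∑' n, P' {ω | Xt ω = n} = 1 := by
    have := Measure.isProbabilityMeasure_map (μ := P') hXm.aemeasurable
    rw [← sum_singleton (P'.map Xt)]
    exact tsum_congr fun n => (Measure.map_apply hXm (measurableSet_singleton n)).symm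
  simp_rw [h.measure_eq_of_identDistrib hc hXt] at h1
  rw [ENNReal.tsum_mul_left, ← hg] at h1
  have h0 : g ≠ ∞ := measure_ne_top _ _
  have h0' : g ≠ 0 := by
    intro h0'
    rw [h0', ENNReal.inv_zero, ENNReal.top_mul'] at h1
    split_ifs at h1
    · exact zero_ne_one h1
    · exact ENNReal.top_ne_one h1
  calc g = g * (g⁻¹ * ∑' n, hitLaw (markedWeight p q) n) := by rw [h1, mul_one]
    _ = _ := by rw [← mul_assoc, ENNReal.mul_inv_cancel h0' h0, one_mul]

end Thinning

lemma ofReal_binomial {γ : ℝ≥0∞} (hγ : γ ≤ 1) (n k : ℕ) :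
    ENNReal.ofReal ((n.choose k : ℝ) * γ.toReal ^ k * (1 - γ.toReal) ^ (n - k)) =
      (n.choose k : ℝ≥0∞) * γ ^ k * (1 - γ) ^ (n - k) := by
  have h0 : γ ≠ ∞ := (hγ.trans_lt ENNReal.one_lt_top).ne
  have h1 : 1 - γ.toReal = (1 - γ).toReal := by
    rw [ENNReal.toReal_sub_of_le hγ ENNReal.one_ne_top, ENNReal.toReal_one]
  have h2 : (1 - γ) ≠ ∞ := ENNReal.sub_ne_top ENNReal.one_ne_top
  rw [h1, ENNReal.ofReal_mul (by positivity), ENNReal.ofReal_mul (by positivity),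
    ENNReal.ofReal_natCast, ENNReal.ofReal_pow ENNReal.toReal_nonneg,
    ENNReal.ofReal_pow ENNReal.toReal_nonneg, ENNReal.ofReal_toReal h0, ENNReal.ofReal_toReal h2]

lemma IsBinomialGiven.map_singleton {Ω : Type*} [MeasurableSpace Ω] {P : Measure Ω}
    {Xt Y : Ω → ℕ} {γ : ℝ≥0∞} (hγ : γ ≤ 1) (hXm : Measurable Xt)
    (hYm : Measurable Y) (hY : IsBinomialGiven P Xt Y γ.toReal) (k : ℕ) :
    P.map Y {k} =
      ∑' n, P {ω | Xt ω = n} * ((n.choose k : ℝ≥0∞) * γ ^ k * (1 - γ) ^ (n - k)) := by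
  rw [Measure.map_apply hYm (measurableSet_singleton k)]
  have h1 : Y ⁻¹' {k} = ⋃ n, {ω | Xt ω = n ∧ Y ω = k} := by
    ext ω
    simp
  rw [h1, measure_iUnion]
  · exact tsum_congr fun n => by rw [hY n k, ofReal_binomial hγ]
  · intro n m hnm
    rw [Function.onFun, Set.disjoint_left]
    rintro ω ⟨h1, _⟩ ⟨h2, _⟩
    exact hnm (h1.symm.trans h2)
  · exact fun n => (hXm (measurableSet_singleton n)).inter (hYm (measurableSet_singleton k))

/-- Rizzolo's map sends a critical marked Galton-Watson tree, conditioned on having a mark, to a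
critical Galton-Watson tree. -/
theorem rizzolo_isGWTree {Ω : Type*} [MeasurableSpace Ω] {P : Measure Ω} [IsProbabilityMeasure P]
    {p : Measure ℕ} (hp : IsOffspringLaw p) (hcrit : mean p = 1)
    {q : ℕ → I} (hpq : ∃ k : ℕ, 0 < p {k} ∧ 0 < (q k : ℝ))
    {τ M : Ω → Set Vertex} (hτ : IsMarkedGWTree P τ M p q)
    {Ω' : Type*} [MeasurableSpace Ω'] {P' : Measure Ω'} [IsProbabilityMeasure P']
    {X : ℕ → Ω' → ℕ} {Z : ℕ → Ω' → Bool} (hXZ : IsMarkedWalk P' X Z p q)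
    {Ω'' : Type*} [MeasurableSpace Ω''] {P'' : Measure Ω''} [IsProbabilityMeasure P'']
    {Xt Y : Ω'' → ℕ} (hXt_meas : Measurable Xt) (hY_meas : Measurable Y)
    (hXt : IdentDistrib (fun ω => (Xt ω : ℤ)) (fun ω => 1 + walk X (markTime Z ω).toNat ω)
      P'' (P'[|{ω | markTime Z ω ≤ hitTime X ω}]))
    (hY : IsBinomialGiven P'' Xt Y (P.real {ω | (M ω).Nonempty})) :
    IsGWTree (P[|{ω | (M ω).Nonempty}]) (fun ω => rizzolo (τ ω) (M ω)) (P''.map Y) ∧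
      IsOffspringLaw (P''.map Y) ∧ mean (P''.map Y) = 1 := by
  have := hp.isProbabilityMeasure
  have hν := Measure.isProbabilityMeasure_map (μ := P'') hY_meas.aemeasurable
  set γ := P {ω | (M ω).Nonempty} with hγdef
  have hγ1 : γ ≤ 1 := prob_le_one
  have hγtop : γ ≠ ∞ := measure_ne_top _ _
  have hc := unmarkedProb_lt_one (q := q) hpq
  have hγsum := hτ.measure_nonempty hp hcrit
  have hhit := hXZ.measure_le_hitTime_eq hc hXt_meas hXt
  rw [← hγdef] at hγsum
  rw [← hγsum] at hhit
  have hlaw : ∀ n, P'' {ω | Xt ω = n} = γ⁻¹ * hitLaw (markedWeight p q) n := fun n => by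
    rw [hXZ.measure_eq_of_identDistrib hc hXt, hhit]
  have hmap := hY.map_singleton (γ := γ) hγ1 hXt_meas hY_meas
  have hw0 : ∑' k, (markedWeight p q true k + markedWeight p q false k) = 1 := by
    simp_rw [markedWeight_add]
    exact sum_singleton p
  have hw1 : ∑' k : ℕ, (k : ℝ≥0∞) * (markedWeight p q true k + markedWeight p q false k) = 1 := by
    simp_rw [markedWeight_add]
    rw [← mean_eq_tsum, hcrit]
  obtain ⟨n, hn2, hn⟩ : ∃ n, 2 ≤ n ∧ hitLaw (markedWeight p q) n ≠ 0 := by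
    obtain ⟨k₀, hk₀, hq₀⟩ := hpq
    obtain ⟨k₁, hk₁, hp₁⟩ : ∃ k₁, 2 ≤ k₁ ∧ p {k₁} ≠ 0 := by
      by_contra! hno
      have h1 := sum_singleton p
      rw [tsum_eq_sum (s := {0, 1}) fun k hk => hno k (by simp at hk; omega)] at h1
      rw [Finset.sum_pair zero_ne_one] at h1
      exact absurd hp.zero_add_one_lt (by rw [h1]; exact lt_irrefl 1)
    refine exists_hitLaw_ne_zero (k₀ := k₀) (k₁ := k₁) ?_ hk₁ (by rwa [markedWeight_add])
    exact mul_ne_zero hk₀.ne' (ENNReal.ofReal_pos.2 hq₀).ne'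
  have hγ0 : γ ≠ 0 := by
    rw [hγsum]
    exact fun h0 => hn (ENNReal.tsum_eq_zero.1 h0 n)
  -- E[Y] = γ E[Xt], and E[Xt] = 1/γ by `tsum_mul_hitLaw`.
  have hmean : mean (P''.map Y) = 1 := by
    rw [mean_eq_tsum]
    simp_rw [hmap, ← ENNReal.tsum_mul_left]
    rw [ENNReal.tsum_comm]
    have h0 : ∀ n k : ℕ, (k : ℝ≥0∞) * (P'' {ω | Xt ω = n} *
        ((n.choose k : ℝ≥0∞) * γ ^ k * (1 - γ) ^ (n - k))) = P'' {ω | Xt ω = n} *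
        ((k : ℝ≥0∞) * ((n.choose k : ℝ≥0∞) * γ ^ k * (1 - γ) ^ (n - k))) := fun n k => by ring
    simp_rw [h0, ENNReal.tsum_mul_left]
    simp_rw [tsum_binomial_mean (add_tsub_cancel_of_le hγ1), hlaw]
    have h1 : ∀ n : ℕ, γ⁻¹ * hitLaw (markedWeight p q) n * (n * γ) =
        γ⁻¹ * γ * (n * hitLaw (markedWeight p q) n) := fun n => by ring
    simp_rw [h1]
    rw [ENNReal.tsum_mul_left, tsum_mul_hitLaw hw0 hw1 hc, ENNReal.inv_mul_cancel hγ0 hγtop,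
      mul_one]
  -- `Y = n` has positive probability because `Xt = n` has, and all `n` trials may succeed.
  have hYn : P''.map Y {n} ≠ 0 := by
    rw [hmap]
    intro h0
    have h1 := ENNReal.tsum_eq_zero.1 h0 n
    rw [hlaw] at h1
    simp only [Nat.choose_self, Nat.cast_one, one_mul, Nat.sub_self, pow_zero, mul_one] at h1
    exact mul_ne_zero (mul_ne_zero (ENNReal.inv_ne_zero.2 hγtop) hn) (pow_ne_zero n hγ0) h1
  refine ⟨?_, isOffspringLaw_of_mean_eq_one hmean hn2 hYn, hmean⟩
  have hcond : IsProbabilityMeasure (P[|{ω | (M ω).Nonempty}]) := cond_isProbabilityMeasure hγ0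
  refine isGWTree_of_branching (measurable_rizzolo hτ.isGWTree.measurable hτ.measurable_marks)
    (fun ω => isTree_rizzolo (hτ.isGWTree.isTree ω) _) fun k B => ?_
  rw [hτ.cond_rizzolo hp hcrit hγ0 B, ← hγdef, hmap, thinLaw, ← ENNReal.tsum_mul_left]
  congr 1
  refine tsum_congr fun N => ?_
  rw [hlaw]
  ring

end MarkedGW

theorem mainTheorem5
    -- a marked Galton-Watson tree with critical offspring distribution `p` and mark function `q`
    {Ω : Type*} [MeasurableSpace Ω] (P : Measure Ω) [IsProbabilityMeasure P]
    (p : Measure ℕ) (hp : MarkedGW.IsOffspringLaw p) (hcrit : MarkedGW.mean p = 1)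
    (q : ℕ → unitInterval) (hpq : ∃ k : ℕ, 0 < p {k} ∧ 0 < (q k : ℝ))
    (τ M : Ω → Set MarkedGW.Vertex) (hτ : MarkedGW.IsMarkedGWTree P τ M p q)
    -- the i.i.d. sequence of pairs `(X_i, Z_i)`
    {Ω' : Type*} [MeasurableSpace Ω'] (P' : Measure Ω') [IsProbabilityMeasure P']
    (X : ℕ → Ω' → ℕ) (Z : ℕ → Ω' → Bool) (hXZ : MarkedGW.IsMarkedWalk P' X Z p q)
    -- `Xt` is distributed as `1 + ∑_{i ≤ N} (X_i - 1)` conditionally on `N ≤ G`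
    {Ω'' : Type*} [MeasurableSpace Ω''] (P'' : Measure Ω'') [IsProbabilityMeasure P'']
    (Xt Y : Ω'' → ℕ) (hXt_meas : Measurable Xt) (hY_meas : Measurable Y)
    (hXt : IdentDistrib (fun ω => (Xt ω : ℤ))
      (fun ω => 1 + MarkedGW.walk X (MarkedGW.markTime Z ω).toNat ω)
      P'' (P'[|{ω | MarkedGW.markTime Z ω ≤ MarkedGW.hitTime X ω}]))
    -- given `Xt`, the variable `Y` is binomial with parameter `(Xt, γ)`, `γ = P(M ≠ ∅)`
    (hY : MarkedGW.IsBinomialGiven P'' Xt Y (P.real {ω | (M ω).Nonempty})) :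
    MarkedGW.IsGWTree (P[|{ω | (M ω).Nonempty}]) (fun ω => MarkedGW.rizzolo (τ ω) (M ω))
        (P''.map Y) ∧
      MarkedGW.IsOffspringLaw (P''.map Y) ∧
      MarkedGW.mean (P''.map Y) = 1 :=
  MarkedGW.rizzolo_isGWTree hp hcrit hpq hτ hXZ hXt_meas hY_meas hXt hY
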